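/- **Programs.** Let $\mathcal B$ (basic blocks), $R$ (registers), $M$ (memory blocks), $Val$ (values) and a set of operators be given. $Val$ contains the addresses of the memory blocks ($M\subseteq Val$) and two distinct truth values $0,1$, and every operator $Op$ denotes a function $\overline{Op}:Val^*\to Val$. A program $p$ is a partial map from control points $(b,n)\in\mathcal B\times\mathbb N$ to the instructions $$r\leftarrow op(Op,\vec v),\quad r\leftarrow load(v),\quad store(v_1,v_2),\quad cond(r,b_{then},b_{else}),\quad goto\ b,$$ with $r\in R$ and operands $v\in R\cup Val$, together with an entry block $b_{init}$ and an ending block $b_{end}$. Each block $b\ne b_{end}$ is a finite sequence of instructions of which exactly the last is a jump ($cond$ or $goto$); $b_{end}$ is a finite, possibly empty, sequence of instructions without jumps, and the program stops behind it, at the final control point. The CFG has an edge $b\to b'$ iff the jump at the end of $b$ has $b'$ as a target. We assume that every branching register (a register $r$ of some instruction $cond(r,\cdot,\cdot)$) is assigned by at most one instruction of the program. **Semantics.** A store gives contents $\rho:R\to Val$ and $\mu:M\to Val$. Execution is the usual one: an $op$ assigns $\overline{Op}$ of the operand values to $r$; a load from address $ad\in M$ assigns $\mu(ad)$ to $r$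 and has the visible action $\mathbf r(ad)$; a store to $ad\in M$ replaces $\mu(ad)$ and has the visible action $\mathbf w(ad)$; $cond$ jumps to $b_{then}$ with visible action $\mathbf j(1)$ if $r$ is $1$ and to $b_{else}$ with visible action $\mathbf j(0)$ if $r$ is $0$; $op$ and $goto$ have no visible action. A complete execution leads from $(b_{init},0)$ to the final control point. Fix a set $\Sigma$ of admissible initial stores (for instance all stores); all executions below start in $\Sigma$. For $X_I,X_O\subseteq R\cup M$, $p$ is *$(X_I,X_O)$-constant-time* if any two complete executions whose initial stores agree on $X_I$ and whose final stores agree on $X_O$ have the same sequence of visible actions. **Control dependencies and points-to information.** $b_1$ dominates (post-dominates) $b_2$ iff every path from $b_{init}$ to $b_2$ (from $b_2$ to $b_{end}$) goes through $b_1$. For $b'\neq b$, $b'\in dep(b)$ iff $b'$ dominates $b$ and no $b''$ that lies, behind $b'$, on a path from $b'$ to $b$ not returning to $b'$ ($b''=b$ allowed) post-dominates $b'$. Whether a block $b$ belongs to $dep(b)$ may be fixed arbitrarily for each $b$. $br(S)$ is the set of registers on which the blocks in $S$ branch. $PtsTo(b,n)(x)\subseteq M$, for $x\in R\cup M$, is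 correct points-to information: if an execution reaches $(b,n)$ with a store in which $x$ contains the address of $m$, then $m\in PtsTo(b,n)(x)$. For an immediate value $w$, $PtsTo(b,n)(w)$ is the set of blocks with address $w$. **Types.** Let $X_O$ be finite and let $\mathcal L$ be the lattice of all sets $\tau_A$, $A\subseteq R\cup M\cup\{\overline o\mid o\in X_O\}$, ordered by inclusion of $A$; write $\tau_x=\tau_{\{x\}}$, $\alpha(o)=\tau_{\overline o}$, $\bot=\tau_\emptyset$. An environment $\Gamma$ maps $R\cup M\cup\{x_l\}$ to $\mathcal L$, where $x_l$ is a fresh leakage variable. For a set $X$, $\Gamma(X)$ and $\alpha(X)$ are joins. $\Gamma[\alpha](x)$ is $\alpha(x)$ if $x\in X_O$ and $\Gamma(x)$ if $x\in (R\cup M)\setminus X_O$; immediate values have type $\bot$, and $\Gamma[\alpha]$ of several operands or variables is the join. $\Gamma\lhd_\alpha o$ is the environment in which, in every $\Gamma(y)$ that contains the atom $\alpha(o)$, this atom is replaced by $\Gamma(o)$; $\Gamma\lhd_\alpha\{o_1,\dots,o_k\}=(\Gamma\lhd_\alpha o_1)\cdots\lhd_\alpha o_k$ for an enumeration of the set without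 repetition. $\Gamma$ is well-formed if the graph on $X_O$ with edges $o_1\to o_2$ for $\alpha(o_1)\sqsubseteq\Gamma(o_2)$ is acyclic. $\Gamma_1\sqsubseteq_r\Gamma_2$ means $\Gamma_1(x)\sqsubseteq\Gamma_2(x)$ for all $x$ and $\alpha(o)\sqsubseteq\Gamma_2(x)\Rightarrow\alpha(o)\sqsubseteq\Gamma_1(x)$ for all $x$ and $o\in X_O$. **Typing rules** for the instruction at $(b,n)$, where $\tau_0(\Gamma)=\Gamma[\alpha](br(dep(b)))$: * $r\leftarrow op(Op,\vec v)$: with $\tau=\Gamma[\alpha](\vec v)\sqcup\tau_0(\Gamma)$, $\Gamma\Rightarrow\Gamma[r\mapsto\tau]$ if $r\notin X_O$, and $\Gamma\Rightarrow(\Gamma\lhd_\alpha r)[r\mapsto\tau]$ if $r\in X_O$. * $r\leftarrow load(v)$: let $\Gamma_1=\Gamma$ if $r\notin X_O$ and $\Gamma_1=\Gamma\lhd_\alpha r$ if $r\in X_O$. With $A_m=PtsTo(b,n)(v)$, $\tau_1=\Gamma_1[\alpha](v)\sqcup\tau_0(\Gamma_1)$, $\tau_2=\Gamma_1[\alpha](A_m)$,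 $\Gamma\Rightarrow\Gamma_1[x_l\mapsto\Gamma_1(x_l)\sqcup\tau_1][r\mapsto\tau_2\sqcup\tau_1]$. * $store(v_1,v_2)$: with $A_m=PtsTo(b,n)(v_2)$, $\Gamma_1=\Gamma\lhd_\alpha(A_m\cap X_O)$, $\tau_1=\Gamma_1[\alpha](v_2)\sqcup\tau_0(\Gamma)$, $\tau_2=\Gamma_1[\alpha](v_1)$, $\Gamma\Rightarrow\Gamma_1[x_l\mapsto\Gamma_1(x_l)\sqcup\tau_1][m\mapsto\Gamma_1(m)\sqcup\tau_2\sqcup\tau_1\text{ for }m\in A_m]$. * $cond(r,b_{then},b_{else})$: $\Gamma\Rightarrow\Gamma[x_l\mapsto\Gamma(x_l)\sqcup\Gamma[\alpha](r)]$. * $goto\ b'$: $\Gamma\Rightarrow\Gamma$. $\vdash_\alpha p:\Gamma\Rightarrow\Gamma'$ means that there are well-formed environments $\Gamma_{(b,n)}$, for all control points, with $\Gamma_{(b_{init},0)}=\Gamma$ and $\Gamma'$ at the final control point, such that for every control point $(b,n)$ and each of its successors $(b',n')$ there are an environment $\gamma$ and a set $A\subseteq X_O$ with $(b,n):\Gamma_{(b,n)}\Rightarrow\gamma$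 and $\gamma\lhd_\alpha A\sqsubseteq_r\Gamma_{(b',n')}$. **Theorem.** Let $\Gamma(x)=\tau_x$ for all $x\in R\cup M$ and $\Gamma(x_l)=\bot$. If $\vdash_\alpha p:\Gamma\Rightarrow\Gamma'$ and $\Gamma'(x_l)\sqsubseteq\Gamma(X_I)\sqcup\alpha(X_O)$, then $p$ is $(X_I,X_O)$-constant-time. -/

import Mathlib

namespace OSCT

/-! ### Syntax of simplified LLVM-IR -/

/-- Operands: a register or an immediate value. -/
inductive Operand (R Val : Type*) where
  | reg (r : R)
  | imm (w : Val)

/-- Instructions, over basic blocks `B`, registers `R`, values `Val` and operators `Op`. -/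
inductive Instr (B R Val Op : Type*) where
  | op (r : R) (f : Op) (vs : List (Operand R Val))
  | load (r : R) (v : Operand R Val)
  | store (v₁ v₂ : Operand R Val)
  | cond (r : R) (bThen bElse : B)
  | goto (b : B)

/-- The jump instructions. -/
def Instr.IsJump {B R Val Op : Type*} : Instr B R Val Op → Prop
  | .cond _ _ _ => True
  | .goto _ => True
  | _ => False

/-- The instruction assigns the register `r`. -/
def Instr.Assigns {B R Val Op : Type*} (r : R) : Instr B R Val Op → Prop
  | .op r' _ _ => r' = r
  | .load r' _ => r' = r
  | _ => False

/-- A program: a partial map from control points `(b, n)` to instructions. Every block other than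
the ending block consists of finitely many instructions, of which exactly the last one is a jump.
The ending block consists of `endLen` instructions, none of which is a jump; the program stops
behind them. -/
structure Program (B R Val Op : Type*) where
  code : B × ℕ → Option (Instr B R Val Op)
  bInit : B
  bEnd : B
  endLen : ℕ
  block : ∀ b, b ≠ bEnd → ∃ k, (∀ n, (code (b, n)).isSome ↔ n ≤ k) ∧
    ∀ n i, code (b, n) = some i → (i.IsJump ↔ n = k)
  endBlock : (∀ n, (code (bEnd, n)).isSome ↔ n < endLen) ∧
    ∀ n i, code (bEnd, n) = some i → ¬ i.IsJump

namespace Program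

variable {B R Val Op : Type*} (P : Program B R Val Op)

/-- The first control point. -/
def start : B × ℕ := (P.bInit, 0)

/-- The final control point. -/
def final : B × ℕ := (P.bEnd, P.endLen)

/-- `P.Succ c c'`: the control point `c'` is a successor of `c`. -/
inductive Succ : B × ℕ → B × ℕ → Prop
  | op {b n r f vs} : P.code (b, n) = some (.op r f vs) → Succ (b, n) (b, n + 1)
  | load {b n r v} : P.code (b, n) = some (.load r v) → Succ (b, n) (b, n + 1)
  | store {b n v₁ v₂} : P.code (b, n) = some (.store v₁ v₂) → Succ (b, n) (b, n + 1)
  | condThen {b n r b₁ b₂} : P.code (b, n) = some (.cond r b₁ b₂) → Succ (b, n) (b₁, 0)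
  | condElse {b n r b₁ b₂} : P.code (b, n) = some (.cond r b₁ b₂) → Succ (b, n) (b₂, 0)
  | goto {b n b'} : P.code (b, n) = some (.goto b') → Succ (b, n) (b', 0)

/-! ### The control-flow graph -/

/-- The edges of the control-flow graph. -/
def Edge (b b' : B) : Prop :=
  ∃ n, P.code (b, n) = some (.goto b') ∨
    ∃ r b'', P.code (b, n) = some (.cond r b' b'') ∨ P.code (b, n) = some (.cond r b'' b')

/-- `l` is the list of the nodes of a path from `b` to `b'`. -/
def IsPath (b b' : B) (l : List B) : Prop :=
  l.head? = some b ∧ l.getLast? = some b' ∧ l.IsChain P.Edge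

/-- Every path from the entry block to `b₂` goes through `b₁`. -/
def Dominates (b₁ b₂ : B) : Prop := ∀ l, P.IsPath P.bInit b₂ l → b₁ ∈ l

/-- Every path from `b₂` to the ending block goes through `b₁`. -/
def PostDominates (b₁ b₂ : B) : Prop := ∀ l, P.IsPath b₂ P.bEnd l → b₁ ∈ l

/-- `b''` lies, behind `b'`, on a path from `b'` to `b` that does not come back to `b'`
(`b'' = b` is possible). -/
def Between (b' b'' b : B) : Prop :=
  ∃ l, b'' ∈ l ∧ b' ∉ l ∧ P.IsPath b' b (b' :: l)

/-- The depending blocks of `b`: the blocks `b'` that dominate `b` such that no block between `b'`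
and `b` post-dominates `b'`. The set `selfDep` fixes which blocks may count as depending on
themselves: `Set.univ` is the reading with reflexive dominance, `∅` that with strict dominance. -/
def dep (selfDep : Set B) (b : B) : Set B :=
  {b' | P.Dominates b' b ∧ (¬ ∃ b'', P.Between b' b'' b ∧ P.PostDominates b'' b') ∧
    (b' = b → b ∈ selfDep)}

/-- The branching registers of the blocks in `S`. -/
def br (S : Set B) : Set R :=
  {r | ∃ b ∈ S, ∃ n b₁ b₂, P.code (b, n) = some (.cond r b₁ b₂)}

/-- Every branching register is assigned by at most one instruction of the program. -/
def BranchRegsAssignedOnce : Prop :=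
  ∀ c r b₁ b₂, P.code c = some (.cond r b₁ b₂) →
    ∀ c₁ c₂ i₁ i₂, P.code c₁ = some i₁ → P.code c₂ = some i₂ →
      i₁.Assigns r → i₂.Assigns r → c₁ = c₂

end Program

/-! ### Labeled operational semantics -/

/-- The parameters of the semantics: the values contain the addresses of the memory blocks `M` and
the two distinct truth values `0` and `1`, and each operator has a (deterministic) meaning. -/
structure Machine (M Val Op : Type*) where
  addr : M ↪ Val
  zero : Val
  one : Val
  zero_ne_one : zero ≠ one
  evalOp : Op → List Val → Val

/-- A store: the contents of the registers and of the memory blocks. -/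
@[ext] structure Store (R M Val : Type*) where
  reg : R → Val
  mem : M → Val

namespace Store

variable {R M Val : Type*}

/-- The content of a variable; variables are registers and memory blocks. -/
def get (σ : Store R M Val) : R ⊕ M → Val
  | .inl r => σ.reg r
  | .inr m => σ.mem m

/-- The value of an operand. -/
def eval (σ : Store R M Val) : Operand R Val → Val
  | .reg r => σ.reg r
  | .imm w => w

open Classical in
/-- Assignment to a register. -/
noncomputable def setReg (σ : Store R M Val) (r : R) (w : Val) : Store R M Val :=
  { σ with reg := Function.update σ.reg r w }

open Classical in
/-- Assignment to a memory block. -/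
noncomputable def setMem (σ : Store R M Val) (m : M) (w : Val) : Store R M Val :=
  { σ with mem := Function.update σ.mem m w }

/-- Equality of two stores on the variables in `X`. -/
def EqOn (X : Set (R ⊕ M)) (σ ρ : Store R M Val) : Prop := ∀ x ∈ X, σ.get x = ρ.get x

end Store

/-- Visible actions: reading at an address, writing at an address, the value of a branching
condition. -/
inductive Action (M : Type*) where
  | read (ad : M)
  | write (ad : M)
  | jump (taken : Bool)

section Semantics

variable {B R M Val Op : Type*} (mach : Machine M Val Op) (P : Program B R Val Op)

/-- One execution step, labeled by the visible action, if there is one. -/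
inductive Step : B × ℕ → Store R M Val → Option (Action M) → B × ℕ → Store R M Val → Prop
  | op {b n σ r f vs} : P.code (b, n) = some (.op r f vs) →
      Step (b, n) σ none (b, n + 1) (σ.setReg r (mach.evalOp f (vs.map σ.eval)))
  | load {b n σ r v ad} : P.code (b, n) = some (.load r v) → σ.eval v = mach.addr ad →
      Step (b, n) σ (some (.read ad)) (b, n + 1) (σ.setReg r (σ.mem ad))
  | store {b n σ v₁ v₂ ad} : P.code (b, n) = some (.store v₁ v₂) → σ.eval v₂ = mach.addr ad →
      Step (b, n) σ (some (.write ad)) (b, n + 1) (σ.setMem ad (σ.eval v₁))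
  | condThen {b n σ r b₁ b₂} : P.code (b, n) = some (.cond r b₁ b₂) → σ.reg r = mach.one →
      Step (b, n) σ (some (.jump true)) (b₁, 0) σ
  | condElse {b n σ r b₁ b₂} : P.code (b, n) = some (.cond r b₁ b₂) → σ.reg r = mach.zero →
      Step (b, n) σ (some (.jump false)) (b₂, 0) σ
  | goto {b n σ b'} : P.code (b, n) = some (.goto b') →
      Step (b, n) σ none (b', 0) σ

/-- `Exec mach P c σ tr c' σ'`: finitely many steps lead from `(c, σ)` to `(c', σ')`, and `tr` is the
sequence of their visible actions. -/
inductive Exec : B × ℕ → Store R M Val → List (Action M) → B × ℕ → Store R M Val → Prop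
  | refl {c σ} : Exec c σ [] c σ
  | step {c σ a c₁ σ₁ tr c₂ σ₂} : Step mach P c σ a c₁ σ₁ → Exec c₁ σ₁ tr c₂ σ₂ →
      Exec c σ (a.toList ++ tr) c₂ σ₂

/-- `(XI, XO)`-constant time, for the executions that start in a store of the set `Init`: any two
complete executions whose initial stores agree on `XI` and whose final stores agree on `XO` have
the same sequence of visible actions. -/
def ConstantTime (Init : Set (Store R M Val)) (XI XO : Set (R ⊕ M)) : Prop :=
  ∀ σ ∈ Init, ∀ ρ ∈ Init, ∀ tr₁ tr₂ σ' ρ',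
    Exec mach P P.start σ tr₁ P.final σ' → Exec mach P P.start ρ tr₂ P.final ρ' →
    Store.EqOn XI σ ρ → Store.EqOn XO σ' ρ' → tr₁ = tr₂

/-- `ptsTo` is correct may-points-to information for the executions that start in `Init`: if, at the
control point `c`, a register or memory block may contain the address of the block `m`, then `m` is
in its points-to set at `c`. -/
def PtsToCorrect (Init : Set (Store R M Val)) (ptsTo : B × ℕ → R ⊕ M → Set M) : Prop :=
  ∀ σ ∈ Init, ∀ tr c σ', Exec mach P P.start σ tr c σ' →
    ∀ x m, σ'.get x = mach.addr m → m ∈ ptsTo c x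

end Semantics

/-! ### Security types and environments -/

/-- The lattice of security types: sets of atoms, where the atoms are the variables (registers and
memory blocks) and a copy of the output variables, ordered by inclusion. -/
abbrev SecType {R M : Type*} (XO : Set (R ⊕ M)) := Set ((R ⊕ M) ⊕ XO)

/-- The type `τ_x` of a variable `x`. -/
def tau {R M : Type*} {XO : Set (R ⊕ M)} (x : R ⊕ M) : SecType XO := {Sum.inl x}

/-- The symbolic type of an output variable. -/
def alpha {R M : Type*} {XO : Set (R ⊕ M)} (o : XO) : SecType XO := {Sum.inr o}

open Classical in
/-- The type `t[t'/α(o)]`: in the decomposition of `t` into atoms, `α(o)` is replaced by `t'`. -/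
noncomputable def replaceAtom {R M : Type*} {XO : Set (R ⊕ M)}
    (t t' : SecType XO) (o : XO) : SecType XO :=
  if alpha o ≤ t then t' ⊔ (t \ alpha o) else t

/-- Type environments: `some x` is a register or memory block, `none` is the leakage variable. -/
abbrev Env {R M : Type*} (XO : Set (R ⊕ M)) := Option (R ⊕ M) → SecType XO

namespace Env

variable {R M : Type*} {XO : Set (R ⊕ M)}

/-- The environment `Γ ◁ o`. -/
noncomputable def tri (Γ : Env XO) (o : XO) : Env XO :=
  fun y => replaceAtom (Γ y) (Γ (some o)) o

/-- `Γ₁` is the environment `Γ ◁ X` for a finite set `X` of output variables: the operation `◁ o`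
is applied once for each `o` in `X`. (For well-formed `Γ` the order does not matter.) -/
def TriSet (Γ : Env XO) (X : Set XO) (Γ₁ : Env XO) : Prop :=
  ∃ l : List XO, l.Nodup ∧ (∀ o, o ∈ l ↔ o ∈ X) ∧ Γ₁ = l.foldl tri Γ

/-- The graph on the output variables with the edges `o₁ → o₂` for `α(o₁) ⊑ Γ(o₂)` is acyclic. -/
def WellFormed (Γ : Env XO) : Prop :=
  ∀ o : XO, ¬ Relation.TransGen (fun o₁ o₂ : XO => alpha o₁ ≤ Γ (some o₂)) o o

/-- The restricted ordering `⊑ᵣ`: no symbolic dependency may be added. -/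
def LeR (Γ₁ Γ₂ : Env XO) : Prop :=
  (∀ x, Γ₁ x ≤ Γ₂ x) ∧ ∀ (o : XO) x, alpha o ≤ Γ₂ x → alpha o ≤ Γ₁ x

open Classical in
/-- The mapping `Γ[α]` on registers and memory blocks. -/
noncomputable def sym (Γ : Env XO) (x : R ⊕ M) : SecType XO :=
  if h : x ∈ XO then alpha ⟨x, h⟩ else Γ (some x)

/-- `Γ[α](v)` for an operand. -/
noncomputable def symOperand {Val : Type*} (Γ : Env XO) : Operand R Val → SecType XO
  | .reg r => Γ.sym (.inl r)
  | .imm _ => ⊥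

/-- `Γ[α](S)` for a set `S` of registers. -/
noncomputable def symRegs (Γ : Env XO) (S : Set R) : SecType XO := ⨆ r ∈ S, Γ.sym (.inl r)

/-- `Γ[α](S)` for a set `S` of memory blocks. -/
noncomputable def symMems (Γ : Env XO) (S : Set M) : SecType XO := ⨆ m ∈ S, Γ.sym (.inr m)

open Classical in
/-- The environment `Γ[x → t]`. -/
noncomputable def set (Γ : Env XO) (x : Option (R ⊕ M)) (t : SecType XO) : Env XO :=
  Function.update Γ x t

open Classical in
/-- In `Γ`, the type `t` is joined to the type of every memory block in `S`. -/
noncomputable def joinMems (Γ : Env XO) (S : Set M) (t : SecType XO) : Env XO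
  | some (.inr m) => if m ∈ S then Γ (some (.inr m)) ⊔ t else Γ (some (.inr m))
  | x => Γ x

end Env

/-! ### The type system -/

section Typing

variable {B R M Val Op : Type*} (mach : Machine M Val Op) (P : Program B R Val Op)
  (selfDep : Set B) (ptsTo : B × ℕ → R ⊕ M → Set M) {XO : Set (R ⊕ M)}

/-- The blocks to which an operand may point at a control point; an immediate value points to the
block of which it is the address. -/
def ptsToOperand (c : B × ℕ) : Operand R Val → Set M
  | .reg r => ptsTo c (.inl r)
  | .imm w => {m | mach.addr m = w}

/-- The type of the branching conditions on which the block `b` depends. -/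
noncomputable def condType (Γ : Env XO) (b : B) : SecType XO :=
  Γ.symRegs (P.br (P.dep selfDep b))

/-- The typing rules for instructions. -/
inductive TypeStep : B × ℕ → Env XO → Env XO → Prop
  | op1 {b n r f vs} {Γ : Env XO} {τ₀ τ : SecType XO} :
      P.code (b, n) = some (.op r f vs) →
      τ₀ = condType P selfDep Γ b →
      τ = (⨆ v ∈ vs, Γ.symOperand v) ⊔ τ₀ →
      Sum.inl r ∉ XO →
      TypeStep (b, n) Γ (Γ.set (some (.inl r)) τ)
  | op2 {b n r f vs} {Γ Γ₁ : Env XO} {τ₀ τ : SecType XO} :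
      P.code (b, n) = some (.op r f vs) →
      τ₀ = condType P selfDep Γ b →
      τ = (⨆ v ∈ vs, Γ.symOperand v) ⊔ τ₀ →
      (hr : Sum.inl r ∈ XO) →
      Γ₁ = Γ.tri ⟨.inl r, hr⟩ →
      TypeStep (b, n) Γ (Γ₁.set (some (.inl r)) τ)
  | ld1 {b n r v} {Γ : Env XO} {τ₀ τ₁ τ₂ : SecType XO} {Am : Set M} :
      P.code (b, n) = some (.load r v) →
      τ₀ = condType P selfDep Γ b →
      Am = ptsToOperand mach ptsTo (b, n) v →
      τ₁ = Γ.symOperand v ⊔ τ₀ →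
      Sum.inl r ∉ XO →
      τ₂ = Γ.symMems Am →
      TypeStep (b, n) Γ ((Γ.set none (Γ none ⊔ τ₁)).set (some (.inl r)) (τ₂ ⊔ τ₁))
  | ld2 {b n r v} {Γ Γ₁ : Env XO} {τ₀ τ₁ τ₂ : SecType XO} {Am : Set M} :
      P.code (b, n) = some (.load r v) →
      τ₀ = condType P selfDep Γ₁ b →
      Am = ptsToOperand mach ptsTo (b, n) v →
      τ₁ = Γ₁.symOperand v ⊔ τ₀ →
      (hr : Sum.inl r ∈ XO) →
      Γ₁ = Γ.tri ⟨.inl r, hr⟩ →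
      τ₂ = Γ₁.symMems Am →
      TypeStep (b, n) Γ ((Γ₁.set none (Γ₁ none ⊔ τ₁)).set (some (.inl r)) (τ₂ ⊔ τ₁))
  | st {b n v₁ v₂} {Γ Γ₁ : Env XO} {τ₀ τ₁ τ₂ : SecType XO} {Am : Set M} {A₀ : Set XO} :
      P.code (b, n) = some (.store v₁ v₂) →
      τ₀ = condType P selfDep Γ b →
      Am = ptsToOperand mach ptsTo (b, n) v₂ →
      A₀ = {o : XO | ∃ m ∈ Am, (o : R ⊕ M) = .inr m} →
      τ₁ = Γ₁.symOperand v₂ ⊔ τ₀ →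
      Γ.TriSet A₀ Γ₁ →
      τ₂ = Γ₁.symOperand v₁ →
      TypeStep (b, n) Γ ((Γ₁.set none (Γ₁ none ⊔ τ₁)).joinMems Am (τ₂ ⊔ τ₁))
  | cjmp {b n r b₁ b₂} {Γ : Env XO} :
      P.code (b, n) = some (.cond r b₁ b₂) →
      TypeStep (b, n) Γ (Γ.set none (Γ none ⊔ Γ.sym (.inl r)))
  | jmp {b n b'} {Γ : Env XO} :
      P.code (b, n) = some (.goto b') →
      TypeStep (b, n) Γ Γ

/-- The program is well typed with initial environment `Γ₀` and final environment `Γ'`: there is a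
family of well-formed environments, one for each control point, that starts with `Γ₀`, ends with
`Γ'`, and is compatible with the typing rules along every edge between control points. -/
def WellTyped (Γ₀ Γ' : Env XO) : Prop :=
  ∃ G : B × ℕ → Env XO, (∀ c, (G c).WellFormed) ∧ G P.start = Γ₀ ∧ G P.final = Γ' ∧
    ∀ c c', P.Succ c c' → ∃ (γ γ' : Env XO) (A : Set XO),
      TypeStep mach P selfDep ptsTo c (G c) γ ∧ γ.TriSet A γ' ∧ γ'.LeR (G c')

end Typing

end OSCT

namespace OSCT

variable {R M : Type*} {XO : Set (R ⊕ M)}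

/-! Two complete executions are compared in lockstep. An atom is bad if it is `τ_y` for a variable
`y` with different initial values, or the symbol of an output variable whose current values differ.
On a common path the invariant `Sound` holds: the type of every differing variable contains a bad
atom, and so does the leakage type once the traces differ. `Sound.typeStep` preserves it, because
the symbol of an output variable is replaced by the type of that variable before an overwriting. At
the final point the leakage type contains only variables that agree initially and outputs that agree
finally, so the traces agree.

Divergence is refuted outright. Let `r` be the branching register on which the stores differ, and
`j` the control point behind its only assignment, or the start. By acyclicity, a bad atom in the
type of `r` at `j` is followed down a chain `r, o₁, …, oₖ, y` of bad atoms (`Env.exists_chain`). The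
branch puts this chain into the leakage type, where it persists along both executions up to
eliminated symbols (`Tracked`). The final leakage type does not contain `τ_y`, so a symbol survives
on each side. A surviving symbol belongs to a variable not overwritten since `j`, and one that
survives on both sides contradicts the agreement of the final outputs.

The common survivor is found in `Tracked.exists_get_eq`, because environments belong to control
points and not to executions. Two runs from `j` to the same point without assignments to `r`
eliminate the same elements of the chain. Runs with such assignments return to `j`, and the loops
eliminate initial segments of the chain, so the later of two survivors survives both. -/

theorem alpha_le_iff {o : XO} {t : SecType XO} : alpha o ≤ t ↔ Sum.inr o ∈ t :=
  Set.singleton_subset_iff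

theorem mem_replaceAtom {t t' : SecType XO} {o : XO} {a : (R ⊕ M) ⊕ XO} :
    a ∈ replaceAtom t t' o ↔ (a ∈ t ∧ a ≠ Sum.inr o) ∨ (Sum.inr o ∈ t ∧ a ∈ t') := by
  unfold replaceAtom
  by_cases h : Sum.inr o ∈ t
  · rw [if_pos (alpha_le_iff.2 h)]
    change a ∈ t' ∪ (t \ {Sum.inr o}) ↔ _
    simp only [Set.mem_union, Set.mem_sdiff, Set.mem_singleton_iff, h, true_and]
    tauto
  · rw [if_neg (fun h' => h (alpha_le_iff.1 h'))]
    constructor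
    · intro ha
      exact Or.inl ⟨ha, fun e => h (e ▸ ha)⟩
    · rintro (⟨ha, -⟩ | ⟨h', -⟩)
      · exact ha
      · exact absurd h' h

namespace Env

theorem mem_tri {Γ : Env XO} {o : XO} {y : Option (R ⊕ M)} {a : (R ⊕ M) ⊕ XO} :
    a ∈ Γ.tri o y ↔ (a ∈ Γ y ∧ a ≠ Sum.inr o) ∨ (Sum.inr o ∈ Γ y ∧ a ∈ Γ (some o)) :=
  mem_replaceAtom

/-! ### Symbolic self-dependencies -/

/-- No output variable depends symbolically on itself. -/
def NoSelf (Γ : Env XO) : Prop := ∀ o : XO, Sum.inr o ∉ Γ (some o)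

theorem WellFormed.noSelf {Γ : Env XO} (h : Γ.WellFormed) : Γ.NoSelf :=
  fun o ho => h o (.single (alpha_le_iff.2 ho))

/-- An edge of the new graph is an old edge or a path of two old edges through `o`. -/
theorem WellFormed.tri {Γ : Env XO} (h : Γ.WellFormed) (o : XO) : (Γ.tri o).WellFormed := by
  intro o₁ h₁
  refine h o₁ (Relation.TransGen.closed ?_ o₁ o₁ h₁)
  intro a b hab
  rcases mem_tri.1 (alpha_le_iff.1 hab) with ⟨h', -⟩ | ⟨h', h''⟩
  · exact .single (alpha_le_iff.2 h')
  · have hb : alpha o ≤ Γ (some b) := alpha_le_iff.2 h'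
    have ha : alpha a ≤ Γ (some o) := alpha_le_iff.2 h''
    exact .tail (.single ha) hb

theorem WellFormed.foldl {Γ : Env XO} (h : Γ.WellFormed) (l : List XO) :
    (l.foldl Env.tri Γ).WellFormed := by
  induction l generalizing Γ with
  | nil => exact h
  | cons o l ih => exact ih (h.tri o)

/-- Only the environments at control points are assumed well-formed; those in the middle of an edge
inherit `NoSelf` backwards from its end. A self-dependency of `o` survives because the substituted
type contains the symbol again. -/
theorem NoSelf.of_tri {Γ : Env XO} {o : XO} (h : (Γ.tri o).NoSelf) : Γ.NoSelf := by
  intro o₁ h₁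
  refine h o₁ (mem_tri.2 ?_)
  by_cases e : o₁ = o
  · subst e; exact Or.inr ⟨h₁, h₁⟩
  · exact Or.inl ⟨h₁, fun e' => e (Sum.inr_injective e')⟩

theorem NoSelf.of_foldl {Γ : Env XO} {l : List XO} (h : (l.foldl Env.tri Γ).NoSelf) :
    Γ.NoSelf := by
  induction l generalizing Γ with
  | nil => exact h
  | cons o l ih => exact (ih h).of_tri

theorem NoSelf.of_leR {Γ Γ' : Env XO} (h : Γ'.NoSelf) (hle : Γ.LeR Γ') : Γ.NoSelf :=
  fun o ho => h o (hle.1 _ ho)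

/-! ### Eliminated symbolic types -/

/-- The type of `x` does not mention the symbols of the output variables in `W`. -/
def Clean (W : Set XO) (Γ : Env XO) (x : Option (R ⊕ M)) : Prop := ∀ o ∈ W, Sum.inr o ∉ Γ x

/-- The types of the output variables outside of `W` do not mention the symbols of `W`. -/
def Closed (W : Set XO) (Γ : Env XO) : Prop := ∀ o : XO, o ∉ W → Clean W Γ (some o)

theorem closed_empty (Γ : Env XO) : Closed ∅ Γ := fun _ _ _ h => h.elim

theorem clean_empty (Γ : Env XO) (x) : Clean ∅ Γ x := fun _ h => h.elim

/-- The substituted type `Γ(o)` brings back neither `o` (`hself`) nor, for `o ∉ W`, any symbol of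
`W` (`hW`). For `o ∈ W` nothing is substituted at `x`. -/
theorem Clean.tri {W : Set XO} {Γ : Env XO} {x} {o : XO} (hself : Sum.inr o ∉ Γ (some o))
    (hW : Closed W Γ) (hx : Clean W Γ x) : Clean (insert o W) (Γ.tri o) x := by
  intro o₁ ho₁ h
  rcases mem_tri.1 h with ⟨h₁, h₂⟩ | ⟨h₁, h₂⟩
  · rcases ho₁ with rfl | ho₁
    · exact h₂ rfl
    · exact hx _ ho₁ h₁
  · by_cases ho : o ∈ W
    · exact hx _ ho h₁
    · rcases ho₁ with rfl | ho₁
      · exact hself h₂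
      · exact hW o ho _ ho₁ h₂

theorem Closed.tri {W : Set XO} {Γ : Env XO} {o : XO} (hself : Sum.inr o ∉ Γ (some o))
    (hW : Closed W Γ) : Closed (insert o W) (Γ.tri o) :=
  fun o' ho' => (hW o' fun h => ho' (Or.inr h)).tri hself hW

theorem Closed.foldl {W : Set XO} {Γ : Env XO} {l : List XO}
    (hself : (l.foldl Env.tri Γ).NoSelf) (hW : Closed W Γ) :
    Closed (W ∪ {o | o ∈ l}) (l.foldl Env.tri Γ) ∧
      ∀ x, Clean W Γ x → Clean (W ∪ {o | o ∈ l}) (l.foldl Env.tri Γ) x := by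
  induction l generalizing Γ W with
  | nil => simpa using hW
  | cons o l ih =>
    have h0 : Γ.NoSelf := NoSelf.of_foldl (l := o :: l) hself
    have := ih hself (hW.tri (h0 o))
    have e : insert o W ∪ {o | o ∈ l} = W ∪ {o' | o' ∈ o :: l} := by
      ext; simp; tauto
    rw [e] at this
    exact ⟨this.1, fun x hx => this.2 x (hx.tri (h0 o) hW)⟩

theorem clean_foldl {Γ : Env XO} (h : Γ.WellFormed) (l : List XO) (x) :
    Clean {o | o ∈ l} (l.foldl Env.tri Γ) x := by
  simpa using ((closed_empty Γ).foldl (h.foldl l).noSelf).2 x (clean_empty Γ x)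

/-! ### Chains of symbolic dependencies -/

/-- `Γ.Chain x [o₁, …, oₖ] y`: the type of `x` contains `α(o₁)`, the type of `o₁` contains `α(o₂)`,
and so on, and the type of `oₖ` contains `τ_y`. -/
def Chain (Γ : Env XO) : Option (R ⊕ M) → List XO → R ⊕ M → Prop
  | x, [], y => Sum.inl y ∈ Γ x
  | x, o :: L, y => Sum.inr o ∈ Γ x ∧ Chain Γ (some o) L y

open Classical in
/-- The elements of `L` outside of `W`. -/
noncomputable def drop (W : Set XO) (L : List XO) : List XO := L.filter (· ∉ W)

theorem mem_drop {W : Set XO} {L : List XO} {o : XO} : o ∈ drop W L ↔ o ∈ L ∧ o ∉ W := by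
  simp [drop]

theorem drop_empty (L : List XO) : drop ∅ L = L := by simp [drop]

theorem drop_drop (W K : Set XO) (L : List XO) : drop K (drop W L) = drop (W ∪ K) L := by
  simp only [drop, List.filter_filter]
  congr 1
  funext o
  by_cases h : o ∈ W <;> by_cases h' : o ∈ K <;> simp [h, h']

theorem drop_cons_of_mem {W : Set XO} {L : List XO} {o : XO} (h : o ∈ W) :
    drop W (o :: L) = drop W L := by simp [drop, h]

theorem drop_cons_of_notMem {W : Set XO} {L : List XO} {o : XO} (h : o ∉ W) :
    drop W (o :: L) = o :: drop W L := by simp [drop, h]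

theorem Chain.of_subset {Γ : Env XO} {x x' L y} (h : Chain Γ x L y) (hx : Γ x ⊆ Γ x') :
    Chain Γ x' L y := by
  cases L with
  | nil => exact hx h
  | cons o L => exact ⟨hx h.1, h.2⟩

theorem Chain.mono {Γ Γ' : Env XO} {x L y} (h : Chain Γ x L y)
    (hx : Γ x ⊆ Γ' x) (hL : ∀ o ∈ L, Γ (some o) ⊆ Γ' (some o)) : Chain Γ' x L y := by
  induction L generalizing x with
  | nil => exact hx h
  | cons o L ih =>
    exact ⟨hx h.1, ih h.2 (hL o (by simp)) fun o' ho' => hL o' (by simp [ho'])⟩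

/-- Substituting `Γ(o)` for the symbol of `o` bypasses the link `o`: its predecessor receives the
atom that followed it. -/
theorem Chain.tri {Γ : Env XO} {x L y} (h : Chain Γ x L y) (o : XO) :
    Chain (Γ.tri o) x (drop {o} L) y := by
  induction L generalizing x with
  | nil => exact mem_tri.2 (Or.inl ⟨h, by simp⟩)
  | cons o₁ L ih =>
    by_cases e : o₁ = o
    · subst e
      rw [drop_cons_of_mem (Set.mem_singleton o₁)]
      refine (ih h.2).of_subset fun a ha => mem_tri.2 (Or.inr ⟨h.1, ?_⟩)
      rcases mem_tri.1 ha with ⟨h', -⟩ | ⟨-, h'⟩ <;> exact h'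
    · rw [drop_cons_of_notMem (by simpa using e)]
      exact ⟨mem_tri.2 (Or.inl ⟨h.1, fun e' => e (Sum.inr_injective e')⟩), ih h.2⟩

theorem Chain.foldl {Γ : Env XO} {x L y} (h : Chain Γ x L y) (l : List XO) :
    Chain (l.foldl Env.tri Γ) x (drop {o | o ∈ l} L) y := by
  induction l generalizing Γ L with
  | nil => simpa [drop] using h
  | cons o l ih =>
    have := ih (h.tri o)
    rw [drop_drop] at this
    have e : ({o} : Set XO) ∪ {o | o ∈ l} = {o' | o' ∈ o :: l} := by
      ext; simp
    rwa [e] at this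

theorem Chain.notMem {Γ : Env XO} {W x L y} (h : Chain Γ x L y) (hW : Closed W Γ)
    (hx : Clean W Γ x) : ∀ o ∈ L, o ∉ W := by
  induction L generalizing x with
  | nil => simp
  | cons o L ih =>
    have ho : o ∉ W := fun ho => hx o ho h.1
    intro o' ho'
    rcases List.mem_cons.1 ho' with rfl | ho'
    · exact ho
    · exact ih h.2 (hW o ho) o' ho'

/-- A chain that has left `W` never enters it again, so its elements in `W` form an initial segment.
-/
theorem Chain.pairwise {Γ : Env XO} {W x L y} (h : Chain Γ x L y) (hW : Closed W Γ) :
    L.Pairwise fun a b => a ∉ W → b ∉ W := by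
  induction L generalizing x with
  | nil => simp
  | cons o L ih =>
    exact List.pairwise_cons.2 ⟨fun b hb ho => h.2.notMem hW (hW o ho) b hb, ih h.2⟩

/-- In a well-formed environment, a property of atoms that passes from every output variable to an
atom of its type can be followed down to a variable. -/
theorem exists_chain (hXO : XO.Finite) {Γ : Env XO} (hΓ : Γ.WellFormed)
    {p : (R ⊕ M) ⊕ XO → Prop} (hp : ∀ o : XO, p (Sum.inr o) → ∃ a ∈ Γ (some o), p a)
    {x a} (ha : a ∈ Γ x) (hpa : p a) :
    ∃ L y, Γ.Chain x L y ∧ p (Sum.inl y) ∧ ∀ o ∈ L, p (Sum.inr o) := by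
  have : Finite XO := hXO
  -- The transitive closure is irreflexive by acyclicity, hence well-founded on the finite set `XO`.
  let r : XO → XO → Prop := Relation.TransGen fun o₁ o₂ => alpha o₁ ≤ Γ (some o₂)
  have : Std.Irrefl r := ⟨hΓ⟩
  have : IsTrans XO r := ⟨fun _ _ _ => Relation.TransGen.trans⟩
  have wf : WellFounded r := Finite.wellFounded_of_trans_of_irrefl r
  have key : ∀ o : XO, p (Sum.inr o) →
      ∃ L y, Γ.Chain (some o) L y ∧ p (Sum.inl y) ∧ ∀ o ∈ L, p (Sum.inr o) := by
    intro o
    induction o using wf.induction with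
    | _ o ih =>
      intro ho
      obtain ⟨a, ha, hpa⟩ := hp o ho
      rcases a with y | o'
      · exact ⟨[], y, ha, hpa, by simp⟩
      · obtain ⟨L, y, h₁, h₂, h₃⟩ := ih o' (.single (alpha_le_iff.2 ha)) hpa
        exact ⟨o' :: L, y, ⟨ha, h₁⟩, h₂, List.forall_mem_cons.2 ⟨hpa, h₃⟩⟩
  rcases a with y | o
  · exact ⟨[], y, ha, hpa, by simp⟩
  · obtain ⟨L, y, h₁, h₂, h₃⟩ := key o hpa
    exact ⟨o :: L, y, ⟨ha, h₁⟩, h₂, List.forall_mem_cons.2 ⟨hpa, h₃⟩⟩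

/-! ### Updates of environments -/

/-- The shape of the change of the environment along an edge between control points: elimination
of symbols, assignments to the variables in `S`, elimination of symbols, weakening. The symbols that
are eliminated are those of `K`. -/
def Upd (Γ : Env XO) (S : Set (R ⊕ M)) (K : Set XO) (Γ' : Env XO) : Prop :=
  ∃ (l : List XO) (γ : Env XO) (l' : List XO), K = {o | o ∈ l} ∪ {o | o ∈ l'} ∧
    (∀ o : XO, (o : R ⊕ M) ∈ S → o ∈ l) ∧
    (∀ x, x ∉ S → γ (some x) = l.foldl tri Γ (some x)) ∧
    l.foldl tri Γ none ≤ γ none ∧ (l'.foldl tri γ).LeR Γ'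

/-- This turns the survival of a symbol into the survival of a value: an output variable outside `K`
is not assigned. -/
theorem Upd.mem {Γ Γ' : Env XO} {S K} (h : Upd Γ S K Γ') {o : XO} (ho : (o : R ⊕ M) ∈ S) :
    o ∈ K := by
  obtain ⟨l, γ, l', rfl, hS, -⟩ := h
  exact Or.inl (hS o ho)

/-- New types go only to variables in `S`, whose output variables lie in `K` and are exempt from
`Closed`. The final weakening adds no symbols. -/
theorem Upd.closed_and_clean {Γ Γ' : Env XO} {S K W} (h : Upd Γ S K Γ') (hΓ : Γ.WellFormed)
    (hΓ' : Γ'.WellFormed) (hW : Closed W Γ) : Closed (W ∪ K) Γ' ∧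
      ∀ x, x ∉ S → Clean W Γ (some x) → Clean (W ∪ K) Γ' (some x) := by
  obtain ⟨l, γ, l', rfl, hS, hγ, -, hle⟩ := h
  have h1 := hW.foldl (hΓ.foldl l).noSelf
  have h2 : Closed (W ∪ {o | o ∈ l}) γ := by
    intro o ho
    have : (o : R ⊕ M) ∉ S := fun h => ho (Or.inr (hS o h))
    intro o' ho'
    rw [hγ o this]
    exact h1.1 o ho o' ho'
  have h3 := h2.foldl (hΓ'.noSelf.of_leR hle)
  rw [Set.union_assoc] at h3
  refine ⟨fun o ho o' ho' h => h3.1 o ho o' ho' ?_, fun x hx hcl o' ho' h => ?_⟩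
  · exact alpha_le_iff.1 (hle.2 _ _ (alpha_le_iff.2 h))
  · refine h3.2 (some x) ?_ o' ho' (alpha_le_iff.1 (hle.2 _ _ (alpha_le_iff.2 h)))
    intro o ho
    rw [hγ x hx]
    exact h1.2 _ hcl o ho

theorem Upd.chain {Γ Γ' : Env XO} {S K x L y} (h : Upd Γ S K Γ') (hx : ∀ z, x = some z → z ∉ S)
    (hL : Chain Γ x L y) : Chain Γ' x (drop K L) y := by
  obtain ⟨l, γ, l', rfl, hS, hγ, hn, hle⟩ := h
  have h1 := hL.foldl l
  have h2 : Chain γ x (drop {o | o ∈ l} L) y := by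
    refine h1.mono ?_ fun o ho => ?_
    · cases x with
      | none => exact hn
      | some z => exact (hγ z (hx z rfl)).ge
    · exact (hγ o fun h => (mem_drop.1 ho).2 (hS o h)).ge
  have h3 := h2.foldl l'
  rw [drop_drop] at h3
  exact h3.mono (hle.1 _) fun o _ => hle.1 _

end Env
end OSCT

namespace OSCT

variable {B R M Val Op : Type*} {XO : Set (R ⊕ M)}

/-! ### Runs -/

/-- The instruction at `c` assigns the register `r`. -/
def Program.AssignsAt (P : Program B R Val Op) (c : B × ℕ) (r : R) : Prop :=
  ∃ i, P.code c = some i ∧ i.Assigns r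

/-- A step from `(c, σ)` to `(c', σ')` that changes only variables in the set `S` of an update from
the environment at `c` to the one at `c'` which eliminates the symbols in `K`. -/
def Link (P : Program B R Val Op) (G : B × ℕ → Env XO) (c : B × ℕ) (σ : Store R M Val)
    (c' : B × ℕ) (σ' : Store R M Val) (K : Set XO) : Prop :=
  ∃ S : Set (R ⊕ M), (G c).Upd S K (G c') ∧ P.Succ c c' ∧ (∀ x, x ∉ S → σ'.get x = σ.get x) ∧
    ∀ r, Sum.inl r ∈ S → P.AssignsAt c r

/-- A sequence of steps from control points with the property `Q`, and the set of the symbols that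
are eliminated on the way. -/
inductive Run (P : Program B R Val Op) (G : B × ℕ → Env XO) (Q : B × ℕ → Prop) (c : B × ℕ)
    (σ : Store R M Val) : Set XO → B × ℕ → Store R M Val → Prop
  | refl : Run P G Q c σ ∅ c σ
  | step {W c₁ σ₁ K c₂ σ₂} : Run P G Q c σ W c₁ σ₁ → Q c₁ → Link P G c₁ σ₁ c₂ σ₂ K →
      Run P G Q c σ (W ∪ K) c₂ σ₂

namespace Run

variable {P : Program B R Val Op} {G : B × ℕ → Env XO} {Q : B × ℕ → Prop}
  {c c' : B × ℕ} {σ σ' : Store R M Val} {W : Set XO}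

theorem mono {Q' : B × ℕ → Prop} (hQ : ∀ c, Q c → Q' c) (h : Run P G Q c σ W c' σ') :
    Run P G Q' c σ W c' σ' := by
  induction h with
  | refl => exact .refl
  | step _ hq hl ih => exact .step ih (hQ _ hq) hl

theorem get_eq (h : Run P G Q c σ W c' σ') {o : XO} (ho : o ∉ W) : σ'.get o = σ.get o := by
  induction h with
  | refl => rfl
  | step _ _ hl ih =>
    obtain ⟨S, hU, -, hS, -⟩ := hl
    rw [hS o fun h => ho (Or.inr (hU.mem h)), ih fun h => ho (Or.inl h)]

theorem closed (hG : ∀ c, (G c).WellFormed) (h : Run P G Q c σ W c' σ') :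
    (G c').Closed W := by
  induction h with
  | refl => exact Env.closed_empty _
  | step _ _ hl ih =>
    obtain ⟨S, hU, -⟩ := hl
    exact (hU.closed_and_clean (hG _) (hG _) ih).1

variable {r : R}

theorem reg_eq (h : Run P G (¬ P.AssignsAt · r) c σ W c' σ') : σ'.reg r = σ.reg r := by
  induction h with
  | refl => rfl
  | step _ hq hl ih =>
    obtain ⟨S, hU, -, hS, hA⟩ := hl
    rw [← ih]
    exact hS (.inl r) fun h => hq (hA r h)

theorem clean (hG : ∀ c, (G c).WellFormed) (h : Run P G (¬ P.AssignsAt · r) c σ W c' σ') :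
    (G c').Clean W (some (.inl r)) := by
  induction h with
  | refl => exact Env.clean_empty _ _
  | step h hq hl ih =>
    obtain ⟨S, hU, -, -, hA⟩ := hl
    exact (hU.closed_and_clean (hG _) (hG _) (h.closed hG)).2 _ (fun h => hq (hA r h)) ih

theorem chain (h : Run P G (¬ P.AssignsAt · r) c σ W c' σ') {L y}
    (hL : (G c).Chain (some (.inl r)) L y) :
    (G c').Chain (some (.inl r)) (Env.drop W L) y := by
  induction h with
  | refl => rwa [Env.drop_empty]
  | step _ hq hl ih =>
    obtain ⟨S, hU, -, -, hA⟩ := hl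
    rw [← Env.drop_drop]
    exact hU.chain (by rintro _ ⟨⟩ h; exact hq (hA r h)) ih

/-- Two runs with the same end points that do not assign `r` eliminate the same elements of a chain
of dependencies of `r`. -/
theorem notMem_of_notMem (hG : ∀ c, (G c).WellFormed) {ρ ρ' : Store R M Val} {W' : Set XO}
    (h : Run P G (¬ P.AssignsAt · r) c σ W c' σ') (h' : Run P G (¬ P.AssignsAt · r) c ρ W' c' ρ')
    {L y} (hL : (G c).Chain (some (.inl r)) L y) {o : XO} (ho : o ∈ L) (hW : o ∉ W) : o ∉ W' :=
  -- The survivors of the first run form a chain of `r` at `c'`, and there no symbol of `W'` can be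
  -- reached from `r`.
  (h.chain hL).notMem (h'.closed hG) (h'.clean hG) o (Env.mem_drop.2 ⟨ho, hW⟩)

/-- If every assignment to `r` leads to `c`, then a run that starts in `c` is a run from `c` to `c`
followed by a run without assignments to `r`. -/
theorem split (hc : ∀ c₁ c₂, P.AssignsAt c₁ r → P.Succ c₁ c₂ → c₂ = c)
    (h : Run P G (fun _ => True) c σ W c' σ') :
    ∃ W₁ W₂ σ₁, W = W₁ ∪ W₂ ∧ Run P G (fun _ => True) c σ W₁ c σ₁ ∧
      Run P G (¬ P.AssignsAt · r) c σ₁ W₂ c' σ' := by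
  induction h with
  | refl => exact ⟨∅, ∅, σ, by simp, .refl, .refl⟩
  | @step W c₁ σ₁ K c₂ σ₂ h hq hl ih =>
    by_cases hA : P.AssignsAt c₁ r
    -- This step leads back to `c`: the whole run so far becomes the loop, and the second run
    -- restarts empty.
    · obtain rfl := hc c₁ c₂ hA hl.choose_spec.2.1
      exact ⟨W ∪ K, ∅, σ₂, by simp, .step h trivial hl, .refl⟩
    · obtain ⟨W₁, W₂, τ, rfl, h₁, h₂⟩ := ih
      exact ⟨W₁, W₂ ∪ K, τ, Set.union_assoc _ _ _, h₁, .step h₂ hA hl⟩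

end Run

/-! ### Divergent executions -/

/-- The dependency chain `L`, `y` of the register `r` at the control point `j` is, up to eliminated
symbols, a dependency chain of the leakage variable in the environment `Γ` after a run from `j`. -/
def Tracked (P : Program B R Val Op) (G : B × ℕ → Env XO) (r : R) (L : List XO) (y : R ⊕ M)
    (j : B × ℕ) (σj : Store R M Val) (c : B × ℕ) (σ : Store R M Val) (Γ : Env XO)
    (W : Set XO) : Prop :=
  (Run P G (fun _ => True) j σj W c σ ∧ Γ.Chain none (Env.drop W L) y) ∨
    ∃ hr : Sum.inl r ∈ XO, Run P G (¬ P.AssignsAt · r) j σj W c σ ∧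
      Γ.Chain none (⟨.inl r, hr⟩ :: Env.drop W L) y

section Tracked

variable {P : Program B R Val Op} {G : B × ℕ → Env XO} {r : R} {L : List XO} {y : R ⊕ M}
  {j c c' : B × ℕ} {σj ρj σ σ' ρ ρ' : Store R M Val} {W W' : Set XO}

/-- The leakage variable is never overwritten, so its chain only loses eliminated symbols. While the
symbol of `r` is present, `r` cannot be assigned; once it is eliminated, assignments to `r` no
longer matter. -/
theorem Tracked.step {Γ : Env XO} {S K} (h : Tracked P G r L y j σj c σ Γ W)
    (hl : Link P G c σ c' σ' K) (hS : ∀ x, P.AssignsAt c x → Sum.inl x ∈ S)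
    (hU : Γ.Upd S K (G c')) : Tracked P G r L y j σj c' σ' (G c') (W ∪ K) := by
  rcases h with ⟨hR, hL⟩ | ⟨hr, hR, hL⟩
  · refine Or.inl ⟨.step hR trivial hl, ?_⟩
    rw [← Env.drop_drop]
    exact hU.chain (by simp) hL
  · have hL' := hU.chain (by simp) hL
    by_cases hK : (⟨.inl r, hr⟩ : XO) ∈ K
    · rw [Env.drop_cons_of_mem hK, Env.drop_drop] at hL'
      exact Or.inl ⟨.step (hR.mono fun _ _ => trivial) trivial hl, hL'⟩
    · rw [Env.drop_cons_of_notMem hK, Env.drop_drop] at hL'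
      exact Or.inr ⟨hr, .step hR (fun hA => hK (hU.mem (o := ⟨.inl r, hr⟩) (hS r hA))) hl, hL'⟩

/-- Being outside `W₁` or `W₂` propagates to the right along `L`, so the later of `o₁` and `o₂`
works. -/
theorem exists_notMem_of_pairwise {L : List XO} {W₁ W₂ W : Set XO}
    (h₁ : L.Pairwise fun a b => a ∉ W₁ → b ∉ W₁) (h₂ : L.Pairwise fun a b => a ∉ W₂ → b ∉ W₂)
    {o₁ o₂ : XO} (ho₁ : o₁ ∈ L) (ho₂ : o₂ ∈ L) (n₁ : o₁ ∉ W₁ ∪ W) (n₂ : o₂ ∉ W₂ ∪ W) :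
    ∃ o ∈ L, o ∉ W₁ ∪ W₂ ∪ W := by
  induction L with
  | nil => simp at ho₁
  | cons o L ih =>
    rw [List.pairwise_cons] at h₁ h₂
    simp only [Set.mem_union, not_or] at *
    rcases List.mem_cons.1 ho₁ with rfl | m₁ <;> rcases List.mem_cons.1 ho₂ with rfl | m₂
    · exact ⟨_, ho₁, ⟨n₁.1, n₂.1⟩, n₁.2⟩
    · exact ⟨o₂, ho₂, ⟨h₁.1 _ m₂ n₁.1, n₂.1⟩, n₂.2⟩
    · exact ⟨o₁, ho₁, ⟨n₁.1, h₂.1 _ m₁ n₂.1⟩, n₁.2⟩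
    · obtain ⟨o', h, h'⟩ := ih h₁.2 h₂.2 m₁ m₂
      exact ⟨o', List.mem_cons_of_mem _ h, h'⟩

theorem Tracked.exists_mem {Γ : Env XO} (hy : Sum.inl y ∉ Γ none)
    (h : Γ.Chain none (Env.drop W L) y) : ∃ o ∈ L, o ∉ W := by
  rcases e : Env.drop W L with _ | ⟨o, L'⟩
  · rw [e] at h
    exact absurd h hy
  · exact ⟨o, Env.mem_drop.1 (e ▸ List.mem_cons_self)⟩

/-- If the same dependency chain is tracked along two runs to the same control point, then one of
the variables of the chain was not changed. -/
theorem Tracked.exists_get_eq (hG : ∀ c, (G c).WellFormed)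
    (hL : (G j).Chain (some (.inl r)) L y) (hy : Sum.inl y ∉ G c none)
    (hj : L = [] ∨ ∀ c₁ c₂, P.AssignsAt c₁ r → P.Succ c₁ c₂ → c₂ = j)
    (h : Tracked P G r L y j σj c σ (G c) W) (h' : Tracked P G r L y j ρj c ρ (G c) W') :
    ∃ x ∈ XO, (x = .inl r ∨ ∃ hx : x ∈ XO, ⟨x, hx⟩ ∈ L) ∧ σ.get x = σj.get x ∧
      ρ.get x = ρj.get x := by
  suffices H : (∃ hr : Sum.inl r ∈ XO, Run P G (¬ P.AssignsAt · r) j σj W c σ ∧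
      Run P G (¬ P.AssignsAt · r) j ρj W' c ρ) ∨ ∃ o ∈ L, o ∉ W ∧ o ∉ W' by
    have hW : ∀ {τj τ W}, Tracked P G r L y j τj c τ (G c) W → ∀ {o : XO}, o ∉ W →
        τ.get o = τj.get o := by
      rintro τj τ W (⟨hR, -⟩ | ⟨-, hR, -⟩) o ho <;> exact hR.get_eq ho
    rcases H with ⟨hr, hR, hR'⟩ | ⟨o, ho, h₁, h₂⟩
    · exact ⟨_, hr, Or.inl rfl, hR.reg_eq, hR'.reg_eq⟩
    · exact ⟨o, o.2, Or.inr ⟨o.2, ho⟩, hW h h₁, hW h' h₂⟩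
  have hsp : ∀ {o : XO}, o ∈ L → ∀ c₁ c₂, P.AssignsAt c₁ r → P.Succ c₁ c₂ → c₂ = j := by
    intro o ho
    rcases hj with rfl | hj
    · simp at ho
    · exact hj
  rcases h with ⟨hR, hC⟩ | ⟨hr, hR, hC⟩ <;> rcases h' with ⟨hR', hC'⟩ | ⟨hr', hR', hC'⟩
  · right
    obtain ⟨o₁, m₁, n₁⟩ := exists_mem hy hC
    obtain ⟨o₂, m₂, n₂⟩ := exists_mem hy hC'
    -- Both runs are cut at a return to `j` after which `r` is not assigned. The tails `W₂` and
    -- `W₂'` contain the same elements of `L`, so `W₂` serves for both; the loops `W₁` and `W₁'`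
    -- contain initial segments.
    obtain ⟨W₁, W₂, τ, rfl, hR₁, hR₂⟩ := hR.split (hsp m₁)
    obtain ⟨W₁', W₂', τ', rfl, hR₁', hR₂'⟩ := hR'.split (hsp m₁)
    obtain ⟨o, m, n⟩ := exists_notMem_of_pairwise (hL.pairwise (hR₁.closed hG))
      (hL.pairwise (hR₁'.closed hG)) m₁ m₂ n₁
      (fun h => h.elim (fun h => n₂ (Or.inl h)) fun h =>
        hR₂'.notMem_of_notMem hG hR₂ hL m₂ (fun h => n₂ (Or.inr h)) h)
    have n' : o ∉ W₂ := fun h => n (Or.inr h)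
    refine ⟨o, m, fun h => h.elim (fun h => n (Or.inl (Or.inl h))) n',
      fun h => h.elim (fun h => n (Or.inl (Or.inr h))) ?_⟩
    exact hR₂.notMem_of_notMem hG hR₂' hL m n'
  · right
    obtain ⟨o, m, n⟩ := exists_mem hy hC
    obtain ⟨W₁, W₂, τ, rfl, hR₁, hR₂⟩ := hR.split (hsp m)
    exact ⟨o, m, n, hR₂.notMem_of_notMem hG hR' hL m fun h => n (Or.inr h)⟩
  · right
    obtain ⟨o, m, n⟩ := exists_mem hy hC'
    obtain ⟨W₁, W₂, τ, rfl, hR₁, hR₂⟩ := hR'.split (hsp m)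
    exact ⟨o, m, hR₂.notMem_of_notMem hG hR hL m fun h => n (Or.inr h), n⟩
  · exact Or.inl ⟨hr, hR, hR'⟩

end Tracked
-- Lookup after updates of stores and environments
namespace Store

variable {σ ρ : Store R M Val}

theorem get_setReg_self (σ : Store R M Val) (r : R) (w : Val) :
    (σ.setReg r w).get (.inl r) = w := by
  simp [get, setReg]

theorem get_setReg_of_ne (σ : Store R M Val) {r : R} (w : Val) {x : R ⊕ M} (h : x ≠ .inl r) :
    (σ.setReg r w).get x = σ.get x := by
  rcases x with r' | m
  · classical exact Function.update_of_ne (fun e => h (congrArg _ e)) _ _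
  · rfl

theorem get_setMem_self (σ : Store R M Val) (m : M) (w : Val) :
    (σ.setMem m w).get (.inr m) = w := by
  simp [get, setMem]

theorem get_setMem_of_ne (σ : Store R M Val) {m : M} (w : Val) {x : R ⊕ M} (h : x ≠ .inr m) :
    (σ.setMem m w).get x = σ.get x := by
  rcases x with r | m'
  · rfl
  · classical exact Function.update_of_ne (fun e => h (congrArg _ e)) _ _

end Store

namespace Env

theorem set_self (Γ : Env XO) (x : Option (R ⊕ M)) (t : SecType XO) : Γ.set x t x = t := by
  simp [set]

theorem set_of_ne (Γ : Env XO) {x y : Option (R ⊕ M)} (t : SecType XO) (h : y ≠ x) :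
    Γ.set x t y = Γ y := by
  simp [set, h]

end Env

/-! ### Inversion of steps -/

section Inversion

variable {mach : Machine M Val Op} {P : Program B R Val Op} {b : B} {n : ℕ} {c c' : B × ℕ}
  {σ σ' : Store R M Val} {a : Option (Action M)}

theorem Step.inv_op {r f vs} (h : Step mach P (b, n) σ a c' σ')
    (hc : P.code (b, n) = some (.op r f vs)) :
    a = none ∧ c' = (b, n + 1) ∧ σ' = σ.setReg r (mach.evalOp f (vs.map σ.eval)) := by
  cases h <;> simp_all

theorem Step.inv_load {r v} (h : Step mach P (b, n) σ a c' σ')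
    (hc : P.code (b, n) = some (.load r v)) :
    ∃ ad, σ.eval v = mach.addr ad ∧ a = some (.read ad) ∧ c' = (b, n + 1) ∧
      σ' = σ.setReg r (σ.mem ad) := by
  cases h <;> simp_all

theorem Step.inv_store {v₁ v₂} (h : Step mach P (b, n) σ a c' σ')
    (hc : P.code (b, n) = some (.store v₁ v₂)) :
    ∃ ad, σ.eval v₂ = mach.addr ad ∧ a = some (.write ad) ∧ c' = (b, n + 1) ∧
      σ' = σ.setMem ad (σ.eval v₁) := by
  cases h <;> simp_all

theorem Step.inv_cond {r b₁ b₂} (h : Step mach P (b, n) σ a c' σ')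
    (hc : P.code (b, n) = some (.cond r b₁ b₂)) :
    σ' = σ ∧ ((σ.reg r = mach.one ∧ a = some (.jump true)) ∨
      (σ.reg r = mach.zero ∧ a = some (.jump false))) := by
  cases h <;> simp_all

theorem Step.inv_goto {b₁} (h : Step mach P (b, n) σ a c' σ')
    (hc : P.code (b, n) = some (.goto b₁)) : a = none ∧ σ' = σ := by
  cases h <;> simp_all

theorem Step.succ (h : Step mach P c σ a c' σ') : P.Succ c c' := by
  cases h with
  | op h => exact .op h
  | load h _ => exact .load h
  | store h _ => exact .store h
  | condThen h _ => exact .condThen h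
  | condElse h _ => exact .condElse h
  | goto h => exact .goto h

theorem Step.exists_cond_of_ne {ρ ρ' : Store R M Val} {a' c''} (h : Step mach P c σ a c' σ')
    (h' : Step mach P c ρ a' c'' ρ') (hne : c' ≠ c'') :
    ∃ r b₁ b₂, P.code c = some (.cond r b₁ b₂) ∧ σ.reg r ≠ ρ.reg r := by
  have h01 := mach.zero_ne_one
  cases h <;> cases h' <;> simp_all
  exact fun e => h01 e.symm

theorem Program.Succ.eq_of_assignsAt {r : R} (hA : P.AssignsAt c r) {c₁ c₂} (h₁ : P.Succ c c₁)
    (h₂ : P.Succ c c₂) : c₁ = c₂ := by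
  obtain ⟨i, hi, hr⟩ := hA
  cases h₁ <;> cases h₂ <;> simp_all <;> exact hr.elim

theorem not_step_final : ¬ Step mach P P.final σ a c' σ' := by
  intro h
  have h0 : ¬ (P.code P.final).isSome := fun h => lt_irrefl _ ((P.endBlock.1 _).1 h)
  generalize P.final = c at *
  cases h <;> simp_all

theorem Exec.snoc {σ₁ σ₂ : Store R M Val} {tr c₁ c₂} (h : Exec mach P c σ tr c₁ σ₁)
    (hs : Step mach P c₁ σ₁ a c₂ σ₂) : Exec mach P c σ (tr ++ a.toList) c₂ σ₂ := by
  induction h with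
  | refl => simpa using Exec.step hs .refl
  | step h _ ih =>
    rw [List.append_assoc]
    exact .step h (ih hs)

end Inversion

/-! ### Typed steps -/

section Typed

variable {mach : Machine M Val Op} {P : Program B R Val Op} {selfDep : Set B}
  {ptsTo : B × ℕ → R ⊕ M → Set M}

theorem mem_ptsToOperand {σ : Store R M Val} {c : B × ℕ} {v : Operand R Val} {m : M}
    (hp : ∀ x m, σ.get x = mach.addr m → m ∈ ptsTo c x) (h : σ.eval v = mach.addr m) :
    m ∈ ptsToOperand mach ptsTo c v := by
  cases v with
  | reg r => exact hp _ _ h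
  | imm w => exact h.symm

theorem joinMems_of_notMem {Γ : Env XO} {S : Set M} {t : SecType XO} {x : R ⊕ M}
    (hx : ∀ m ∈ S, x ≠ .inr m) : Γ.joinMems S t (some x) = Γ (some x) := by
  rcases x with r | m
  · rfl
  · exact if_neg fun h => hx m h rfl

theorem joinMems_of_mem {Γ : Env XO} {S : Set M} {t : SecType XO} {m : M} (hm : m ∈ S) :
    Γ.joinMems S t (some (.inr m)) = Γ (some (.inr m)) ⊔ t :=
  if_pos hm

/-- This forgets the assigned types and keeps what `Upd` and `Link` need. For a store, correctness
of the points-to sets puts the block actually written into `S`. -/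
theorem TypeStep.shape {c c' : B × ℕ} {Γ γ : Env XO} {σ σ' : Store R M Val} {a}
    (h : TypeStep mach P selfDep ptsTo c Γ γ) (hs : Step mach P c σ a c' σ')
    (hp : ∀ x m, σ.get x = mach.addr m → m ∈ ptsTo c x) :
    ∃ (S : Set (R ⊕ M)) (l : List XO), (∀ o : XO, (o : R ⊕ M) ∈ S → o ∈ l) ∧
      (∀ x, x ∉ S → γ (some x) = l.foldl Env.tri Γ (some x)) ∧
      l.foldl Env.tri Γ none ≤ γ none ∧ (∀ x, x ∉ S → σ'.get x = σ.get x) ∧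
      ∀ r, Sum.inl r ∈ S ↔ P.AssignsAt c r := by
  cases h with
  | op1 hc _ _ hr =>
    obtain ⟨-, -, rfl⟩ := hs.inv_op hc
    refine ⟨{.inl _}, [], ?_, fun x hx => Env.set_of_ne _ _ (by simpa using hx),
      (Env.set_of_ne _ _ (by simp)).ge, fun x hx => Store.get_setReg_of_ne _ _ hx, fun r => ?_⟩
    · intro o ho
      exact absurd (ho ▸ o.2) hr
    · simp [Program.AssignsAt, hc, Instr.Assigns, eq_comm]
  | op2 hc _ _ hr h1 =>
    obtain ⟨-, -, rfl⟩ := hs.inv_op hc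
    subst h1
    refine ⟨{.inl _}, [⟨_, hr⟩], ?_, fun x hx => Env.set_of_ne _ _ (by simpa using hx),
      (Env.set_of_ne _ _ (by simp)).ge, fun x hx => Store.get_setReg_of_ne _ _ hx, fun r => ?_⟩
    · intro o ho
      exact List.mem_singleton.2 (Subtype.ext ho)
    · simp [Program.AssignsAt, hc, Instr.Assigns, eq_comm]
  | ld1 hc _ _ _ hr _ =>
    obtain ⟨ad, -, -, -, rfl⟩ := hs.inv_load hc
    refine ⟨{.inl _}, [], ?_, fun x hx => ?_, ?_,
      fun x hx => Store.get_setReg_of_ne _ _ hx, fun r => ?_⟩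
    · intro o ho
      exact absurd (ho ▸ o.2) hr
    · rw [Env.set_of_ne _ _ (by simpa using hx), Env.set_of_ne _ _ (by simp)]
      rfl
    · rw [Env.set_of_ne _ _ (by simp), Env.set_self]
      exact le_sup_left
    · simp [Program.AssignsAt, hc, Instr.Assigns, eq_comm]
  | ld2 hc _ _ _ hr h1 _ =>
    obtain ⟨ad, -, -, -, rfl⟩ := hs.inv_load hc
    subst h1
    refine ⟨{.inl _}, [⟨_, hr⟩], ?_, fun x hx => ?_, ?_,
      fun x hx => Store.get_setReg_of_ne _ _ hx, fun r => ?_⟩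
    · intro o ho
      exact List.mem_singleton.2 (Subtype.ext ho)
    · rw [Env.set_of_ne _ _ (by simpa using hx), Env.set_of_ne _ _ (by simp)]
      rfl
    · rw [Env.set_of_ne _ _ (by simp), Env.set_self]
      exact le_sup_left
    · simp [Program.AssignsAt, hc, Instr.Assigns, eq_comm]
  | @st b n v₁ v₂ _ Γ₁ τ₀ τ₁ τ₂ Am A₀ hc _ hAm hA₀ _ h1 _ =>
    obtain ⟨ad, had, -, -, rfl⟩ := hs.inv_store hc
    obtain ⟨l, -, hl, rfl⟩ := h1
    have hmem : ad ∈ Am := hAm ▸ mem_ptsToOperand hp had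
    refine ⟨{x | ∃ m ∈ Am, x = .inr m}, l, ?_, fun x hx => ?_, ?_, fun x hx => ?_, fun r => ?_⟩
    · intro o ho
      rw [hl, hA₀]
      exact ho
    · rw [joinMems_of_notMem fun m hm e => hx ⟨m, hm, e⟩, Env.set_of_ne _ _ (by simp)]
    · change _ ≤ Env.set _ none _ none
      rw [Env.set_self]
      exact le_sup_left
    · exact Store.get_setMem_of_ne _ _ fun e => hx ⟨ad, hmem, e⟩
    · simp [Program.AssignsAt, hc, Instr.Assigns]
  | cjmp hc =>
    obtain ⟨rfl, -⟩ := hs.inv_cond hc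
    refine ⟨∅, [], by simp, fun x _ => Env.set_of_ne _ _ (by simp), ?_, fun _ _ => rfl,
      fun r => ?_⟩
    · rw [Env.set_self]
      exact le_sup_left
    · simp [Program.AssignsAt, hc, Instr.Assigns]
  | jmp hc =>
    obtain ⟨-, rfl⟩ := hs.inv_goto hc
    refine ⟨∅, [], by simp, fun x _ => rfl, le_rfl, fun _ _ => rfl, fun r => ?_⟩
    simp [Program.AssignsAt, hc, Instr.Assigns]

/-! ### Soundness for executions on the same path -/

/-- The atoms whose values differ: those of the variables in `I`, and those of the output variables
on which two stores differ. -/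
def Bad (I : Set (R ⊕ M)) (σ ρ : Store R M Val) : (R ⊕ M) ⊕ XO → Prop
  | .inl y => y ∈ I
  | .inr o => σ.get o ≠ ρ.get o

/-- The environment accounts for the differences of two stores, and for the proposition `D` that
the traces differ. -/
def Sound (I : Set (R ⊕ M)) (Γ : Env XO) (σ ρ : Store R M Val) (D : Prop) : Prop :=
  (∀ x, σ.get x ≠ ρ.get x → ∃ a ∈ Γ (some x), Bad I σ ρ a) ∧ (D → ∃ a ∈ Γ none, Bad I σ ρ a)

namespace Sound

variable {I : Set (R ⊕ M)} {Γ Γ' γ : Env XO} {σ ρ σ' ρ' : Store R M Val} {D D' : Prop}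

/-- If the bad atom is the replaced symbol of `o`, then the stores differ at `o`, and `Γ(o)`
supplies another bad atom. -/
theorem exists_tri (h : Sound I Γ σ ρ D) (o : XO) {y} (hy : ∃ a ∈ Γ y, Bad I σ ρ a) :
    ∃ a ∈ Γ.tri o y, Bad I σ ρ a := by
  obtain ⟨a, ha, hb⟩ := hy
  by_cases e : a = Sum.inr o
  · subst e
    obtain ⟨a', ha', hb'⟩ := h.1 o hb
    exact ⟨a', Env.mem_tri.2 (Or.inr ⟨ha, ha'⟩), hb'⟩
  · exact ⟨a, Env.mem_tri.2 (Or.inl ⟨ha, e⟩), hb⟩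

theorem tri (h : Sound I Γ σ ρ D) (o : XO) : Sound I (Γ.tri o) σ ρ D :=
  ⟨fun x hx => h.exists_tri o (h.1 x hx), fun hD => h.exists_tri o (h.2 hD)⟩

theorem foldl (h : Sound I Γ σ ρ D) (l : List XO) : Sound I (l.foldl Env.tri Γ) σ ρ D := by
  induction l generalizing Γ with
  | nil => exact h
  | cons o l ih => exact ih (h.tri o)

theorem mono (h : Sound I Γ σ ρ D) (hle : ∀ x, Γ x ≤ Γ' x) : Sound I Γ' σ ρ D :=
  ⟨fun x hx => let ⟨a, ha, hb⟩ := h.1 x hx; ⟨a, hle _ ha, hb⟩,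
    fun hD => let ⟨a, ha, hb⟩ := h.2 hD; ⟨a, hle _ ha, hb⟩⟩

theorem exists_sym (h : Sound I Γ σ ρ D) {x} (hx : σ.get x ≠ ρ.get x) :
    ∃ a ∈ Γ.sym x, Bad I σ ρ a := by
  unfold Env.sym
  split
  · exact ⟨_, rfl, hx⟩
  · exact h.1 x hx

theorem exists_symOperand (h : Sound I Γ σ ρ D) {v : Operand R Val} (hv : σ.eval v ≠ ρ.eval v) :
    ∃ a ∈ Γ.symOperand v, Bad I σ ρ a := by
  cases v with
  | reg r => exact h.exists_sym (x := .inl r) hv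
  | imm w => exact absurd rfl hv

/-- A bad atom stays bad unless it is the symbol of an overwritten output variable. Hence such
symbols must be absent from `Γ` and from the new witnesses. -/
theorem modify {S : Set (R ⊕ M)} (h : Sound I Γ σ ρ D)
    (hcl : ∀ o : XO, (o : R ⊕ M) ∈ S → ∀ x, Sum.inr o ∉ Γ x)
    (hγ : ∀ x, x ∉ S → γ (some x) = Γ (some x)) (hn : Γ none ≤ γ none)
    (hσ : ∀ x, x ∉ S → σ'.get x = σ.get x) (hρ : ∀ x, x ∉ S → ρ'.get x = ρ.get x)
    (hS : ∀ x ∈ S, σ'.get x ≠ ρ'.get x →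
      ∃ a ∈ γ (some x), Bad I σ ρ a ∧ ∀ o : XO, a = Sum.inr o → (o : R ⊕ M) ∉ S)
    (hD : D' → ∃ a ∈ γ none, Bad I σ ρ a ∧ ∀ o : XO, a = Sum.inr o → (o : R ⊕ M) ∉ S) :
    Sound I γ σ' ρ' (D ∨ D') := by
  have key : ∀ a : (R ⊕ M) ⊕ XO, Bad I σ ρ a → (∀ o : XO, a = Sum.inr o → (o : R ⊕ M) ∉ S) →
      Bad I σ' ρ' a := by
    rintro (y | o) ha ho
    · exact ha
    · change _ ≠ _
      rw [hσ _ (ho o rfl), hρ _ (ho o rfl)]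
      exact ha
  constructor
  · intro x hx
    by_cases hxS : x ∈ S
    · obtain ⟨a, ha, hb, ho⟩ := hS x hxS hx
      exact ⟨a, ha, key a hb ho⟩
    · rw [hσ x hxS, hρ x hxS] at hx
      obtain ⟨a, ha, hb⟩ := h.1 x hx
      rw [hγ x hxS]
      exact ⟨a, ha, key a hb fun o e hoS => hcl o hoS _ (e ▸ ha)⟩
  · rintro (hD' | hD')
    · obtain ⟨a, ha, hb⟩ := h.2 hD'
      exact ⟨a, hn ha, key a hb fun o e hoS => hcl o hoS _ (e ▸ ha)⟩
    · obtain ⟨a, ha, hb, ho⟩ := hD hD'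
      exact ⟨a, ha, key a hb ho⟩

theorem load_step {Γ₁ : Env XO} {r : R} {v : Operand R Val} {Am : Set M} {τ₀ : SecType XO}
    {ad ad' : M} (h : Sound I Γ₁ σ ρ D)
    (hcl : ∀ o : XO, (o : R ⊕ M) = .inl r → ∀ x, Sum.inr o ∉ Γ₁ x)
    (hself : ((Γ₁.set none (Γ₁ none ⊔ (Γ₁.symOperand v ⊔ τ₀))).set (some (.inl r))
      (Γ₁.symMems Am ⊔ (Γ₁.symOperand v ⊔ τ₀))).NoSelf)
    (had : σ.eval v = mach.addr ad) (had' : ρ.eval v = mach.addr ad') (hm : ad ∈ Am) :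
    Sound I ((Γ₁.set none (Γ₁ none ⊔ (Γ₁.symOperand v ⊔ τ₀))).set (some (.inl r))
      (Γ₁.symMems Am ⊔ (Γ₁.symOperand v ⊔ τ₀))) (σ.setReg r (σ.mem ad)) (ρ.setReg r (ρ.mem ad'))
      (D ∨ some (Action.read ad) ≠ some (Action.read ad')) := by
  have hr : ∀ a ∈ Γ₁.symMems Am ⊔ (Γ₁.symOperand v ⊔ τ₀), ∀ o : XO, a = Sum.inr o →
      (o : R ⊕ M) ∉ ({.inl r} : Set (R ⊕ M)) := by
    rintro a ha o rfl ho
    refine hself o ?_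
    rw [show (o : R ⊕ M) = .inl r from ho, Env.set_self]
    exact ha
  have hv : ad ≠ ad' → ∃ a ∈ Γ₁.symOperand v, Bad I σ ρ a := fun hne =>
    h.exists_symOperand fun e => hne (mach.addr.injective (by rw [← had, e, had']))
  refine h.modify (S := {.inl r}) hcl (fun x hx => ?_) ?_
    (fun x hx => Store.get_setReg_of_ne _ _ hx) (fun x hx => Store.get_setReg_of_ne _ _ hx) ?_ ?_
  · rw [Env.set_of_ne _ _ (by simpa using hx), Env.set_of_ne _ _ (by simp)]
  · rw [Env.set_of_ne _ _ (by simp), Env.set_self]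
    exact le_sup_left
  · rintro _ rfl hx
    rw [Store.get_setReg_self, Store.get_setReg_self] at hx
    rw [Env.set_self]
    suffices H : ∃ a ∈ Γ₁.symMems Am ⊔ (Γ₁.symOperand v ⊔ τ₀), Bad I σ ρ a by
      obtain ⟨a, ha, hb⟩ := H
      exact ⟨a, ha, hb, hr a ha⟩
    -- The points-to set matters only for equal addresses. Different addresses already give a bad
    -- atom in the type of `v`.
    by_cases e : ad = ad'
    · subst e
      obtain ⟨a, ha, hb⟩ := h.exists_sym (x := .inr ad) hx
      refine ⟨a, Or.inl ?_, hb⟩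
      exact Set.mem_iUnion₂.2 ⟨ad, hm, ha⟩
    · obtain ⟨a, ha, hb⟩ := hv e
      exact ⟨a, Or.inr (Or.inl ha), hb⟩
  · intro hne
    obtain ⟨a, ha, hb⟩ := hv fun e => hne (by rw [e])
    refine ⟨a, ?_, hb, hr a (Or.inr (Or.inl ha))⟩
    rw [Env.set_of_ne _ _ (by simp), Env.set_self]
    exact Or.inr (Or.inl ha)

/-- The operands are typed in `Γ`, before the symbol of `r` is eliminated, while the update acts on
`Γ₁`; both environments are sound for the stores before the step. -/
theorem op_step {Γ₁ : Env XO} {r : R} {f : Op} {vs : List (Operand R Val)} {τ₀ : SecType XO}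
    (h : Sound I Γ σ ρ D) (h₁ : Sound I Γ₁ σ ρ D)
    (hcl : ∀ o : XO, (o : R ⊕ M) = .inl r → ∀ x, Sum.inr o ∉ Γ₁ x)
    (hself : (Γ₁.set (some (.inl r)) ((⨆ v ∈ vs, Γ.symOperand v) ⊔ τ₀)).NoSelf) :
    Sound I (Γ₁.set (some (.inl r)) ((⨆ v ∈ vs, Γ.symOperand v) ⊔ τ₀))
      (σ.setReg r (mach.evalOp f (vs.map σ.eval))) (ρ.setReg r (mach.evalOp f (vs.map ρ.eval)))
      (D ∨ (none : Option (Action M)) ≠ none) := by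
  refine h₁.modify (S := {.inl r}) hcl (fun x hx => Env.set_of_ne _ _ (by simpa using hx))
    (Env.set_of_ne _ _ (by simp)).ge (fun x hx => Store.get_setReg_of_ne _ _ hx)
    (fun x hx => Store.get_setReg_of_ne _ _ hx) ?_ (fun h => absurd rfl h)
  rintro _ rfl hx
  rw [Store.get_setReg_self, Store.get_setReg_self] at hx
  obtain ⟨v, hv, hne⟩ : ∃ v ∈ vs, σ.eval v ≠ ρ.eval v := by
    by_contra! H
    exact hx (by rw [List.map_congr_left H])
  obtain ⟨a, ha, hb⟩ := h.exists_symOperand hne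
  have ha' : a ∈ (⨆ v ∈ vs, Γ.symOperand v) ⊔ τ₀ := Or.inl (Set.mem_iUnion₂.2 ⟨v, hv, ha⟩)
  refine ⟨a, by rwa [Env.set_self], hb, ?_⟩
  rintro o rfl ho
  refine hself o ?_
  rwa [show (o : R ⊕ M) = .inl r from ho, Env.set_self]

theorem store_step {Γ₁ : Env XO} {v₁ v₂ : Operand R Val} {Am : Set M} {τ₀ : SecType XO}
    {ad ad' : M} (h : Sound I Γ₁ σ ρ D)
    (hcl : ∀ o : XO, (∃ m ∈ Am, (o : R ⊕ M) = .inr m) → ∀ x, Sum.inr o ∉ Γ₁ x)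
    (had : σ.eval v₂ = mach.addr ad) (had' : ρ.eval v₂ = mach.addr ad') (hm : ad ∈ Am)
    (hm' : ad' ∈ Am) :
    Sound I ((Γ₁.set none (Γ₁ none ⊔ (Γ₁.symOperand v₂ ⊔ τ₀))).joinMems Am
      (Γ₁.symOperand v₁ ⊔ (Γ₁.symOperand v₂ ⊔ τ₀))) (σ.setMem ad (σ.eval v₁))
      (ρ.setMem ad' (ρ.eval v₁)) (D ∨ some (Action.write ad) ≠ some (Action.write ad')) := by
  -- The type of an operand is the symbol of a register or a type in `Γ₁`, so it contains no symbol
  -- of a block that may be overwritten.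
  have hop : ∀ v : Operand R Val, ∀ a ∈ Γ₁.symOperand v, ∀ o : XO, a = Sum.inr o →
      (o : R ⊕ M) ∉ {x : R ⊕ M | ∃ m ∈ Am, x = .inr m} := by
    rintro (r | w) a ha o rfl ho
    · change Sum.inr o ∈ Env.sym _ _ at ha
      unfold Env.sym at ha
      split at ha
      · obtain rfl := Sum.inr_injective ha
        obtain ⟨m, -, hm⟩ := ho
        cases hm
      · exact hcl o ho _ ha
    · exact ha
  have hv : ad ≠ ad' → ∃ a ∈ Γ₁.symOperand v₂, Bad I σ ρ a := fun hne =>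
    h.exists_symOperand fun e => hne (mach.addr.injective (by rw [← had, e, had']))
  refine h.modify (S := {x : R ⊕ M | ∃ m ∈ Am, x = .inr m}) hcl (fun x hx => ?_) ?_
    (fun x hx => Store.get_setMem_of_ne _ _ fun e => hx ⟨ad, hm, e⟩)
    (fun x hx => Store.get_setMem_of_ne _ _ fun e => hx ⟨ad', hm', e⟩) ?_ ?_
  · rw [joinMems_of_notMem fun m hm e => hx ⟨m, hm, e⟩, Env.set_of_ne _ _ (by simp)]
  · change _ ≤ Env.set _ none _ none
    rw [Env.set_self]
    exact le_sup_left
  · rintro _ ⟨m, hmA, rfl⟩ hx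
    rw [joinMems_of_mem hmA, Env.set_of_ne _ _ (by simp)]
    by_cases e : ad = ad'
    · subst e
      by_cases em : m = ad
      · subst em
        rw [Store.get_setMem_self, Store.get_setMem_self] at hx
        obtain ⟨a, ha, hb⟩ := h.exists_symOperand hx
        exact ⟨a, Or.inr (Or.inl ha), hb, hop _ a ha⟩
      · have em' : (Sum.inr m : R ⊕ M) ≠ .inr ad := fun e => em (Sum.inr_injective e)
        rw [Store.get_setMem_of_ne _ _ em', Store.get_setMem_of_ne _ _ em'] at hx
        obtain ⟨a, ha, hb⟩ := h.1 _ hx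
        exact ⟨a, Or.inl ha, hb, fun o e ho => hcl o ho _ (e ▸ ha)⟩
    · obtain ⟨a, ha, hb⟩ := hv e
      exact ⟨a, Or.inr (Or.inr (Or.inl ha)), hb, hop _ a ha⟩
  · intro hne
    obtain ⟨a, ha, hb⟩ := hv fun e => hne (by rw [e])
    refine ⟨a, ?_, hb, hop _ a ha⟩
    change _ ∈ Env.set _ none _ none
    rw [Env.set_self]
    exact Or.inr (Or.inl ha)

theorem typeStep {c c' c'' : B × ℕ} {a₁ a₂} (h : Sound I Γ σ ρ D) (hΓ : Γ.WellFormed)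
    (hγ : γ.NoSelf) (ht : TypeStep mach P selfDep ptsTo c Γ γ)
    (hs : Step mach P c σ a₁ c' σ') (hs' : Step mach P c ρ a₂ c'' ρ')
    (hp : ∀ x m, σ.get x = mach.addr m → m ∈ ptsTo c x)
    (hp' : ∀ x m, ρ.get x = mach.addr m → m ∈ ptsTo c x) :
    Sound I γ σ' ρ' (D ∨ a₁ ≠ a₂) := by
  have hcl : ∀ {r : R} (hr : Sum.inl r ∈ XO) (o : XO), (o : R ⊕ M) = .inl r → ∀ x,
      Sum.inr o ∉ Γ.tri ⟨_, hr⟩ x := fun hr o ho x =>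
    Env.clean_foldl hΓ [⟨_, hr⟩] x o (List.mem_singleton.2 (Subtype.ext ho))
  cases ht with
  | op1 hc _ h2 hr =>
    obtain ⟨rfl, -, rfl⟩ := hs.inv_op hc
    obtain ⟨rfl, -, rfl⟩ := hs'.inv_op hc
    subst h2
    exact h.op_step h (fun o ho => absurd (ho ▸ o.2) hr) hγ
  | op2 hc _ h2 hr h3 =>
    obtain ⟨rfl, -, rfl⟩ := hs.inv_op hc
    obtain ⟨rfl, -, rfl⟩ := hs'.inv_op hc
    subst h2 h3
    exact h.op_step (h.tri _) (hcl hr) hγ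
  | ld1 hc _ hA h2 hr h3 =>
    obtain ⟨ad, had, rfl, -, rfl⟩ := hs.inv_load hc
    obtain ⟨ad', had', rfl, -, rfl⟩ := hs'.inv_load hc
    subst h2 h3
    exact h.load_step (fun o ho => absurd (ho ▸ o.2) hr) hγ had had'
      (hA ▸ mem_ptsToOperand hp had)
  | ld2 hc _ hA h2 hr h4 h3 =>
    obtain ⟨ad, had, rfl, -, rfl⟩ := hs.inv_load hc
    obtain ⟨ad', had', rfl, -, rfl⟩ := hs'.inv_load hc
    subst h2 h3 h4
    exact (h.tri _).load_step (hcl hr) hγ had had' (hA ▸ mem_ptsToOperand hp had)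
  | st hc _ hA hA₀ h2 h1 h3 =>
    obtain ⟨ad, had, rfl, -, rfl⟩ := hs.inv_store hc
    obtain ⟨ad', had', rfl, -, rfl⟩ := hs'.inv_store hc
    obtain ⟨l, -, hl, rfl⟩ := h1
    subst h2 h3
    refine (h.foldl l).store_step (fun o ho x => ?_) had had' (hA ▸ mem_ptsToOperand hp had)
      (hA ▸ mem_ptsToOperand hp' had')
    refine Env.clean_foldl hΓ l x o ?_
    change o ∈ l
    rw [hl, hA₀]
    exact ho
  | @cjmp b n r b₁ b₂ _ hc =>
    obtain ⟨rfl, ha⟩ := hs.inv_cond hc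
    obtain ⟨rfl, ha'⟩ := hs'.inv_cond hc
    refine h.modify (S := ∅) (by simp) (fun x _ => Env.set_of_ne _ _ (by simp)) ?_
      (fun _ _ => rfl) (fun _ _ => rfl) (by simp) fun hne => ?_
    · rw [Env.set_self]
      exact le_sup_left
    · have : σ'.get (.inl r) ≠ ρ'.get (.inl r) := by
        intro e
        have e : σ'.reg r = ρ'.reg r := e
        have h01 := mach.zero_ne_one
        rcases ha with ⟨h1, rfl⟩ | ⟨h1, rfl⟩ <;> rcases ha' with ⟨h2, rfl⟩ | ⟨h2, rfl⟩ <;>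
          simp_all
      obtain ⟨a, ha, hb⟩ := h.exists_sym this
      refine ⟨a, ?_, hb, by simp⟩
      rw [Env.set_self]
      exact Or.inr ha
  | jmp hc =>
    obtain ⟨rfl, rfl⟩ := hs.inv_goto hc
    obtain ⟨rfl, rfl⟩ := hs'.inv_goto hc
    simpa using h

end Sound

end Typed
-- Divergence and the comparison of complete executions
section Main

variable {mach : Machine M Val Op} {P : Program B R Val Op} {selfDep : Set B}
  {ptsTo : B × ℕ → R ⊕ M → Set M} {G : B × ℕ → Env XO} {Init : Set (Store R M Val)}

/-- The compatibility of the environment at `c'` with the typing rule at `c`. -/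
def EdgeTyped (mach : Machine M Val Op) (P : Program B R Val Op) (selfDep : Set B)
    (ptsTo : B × ℕ → R ⊕ M → Set M) (G : B × ℕ → Env XO) (c c' : B × ℕ) : Prop :=
  ∃ (γ γ' : Env XO) (A : Set XO),
    TypeStep mach P selfDep ptsTo c (G c) γ ∧ γ.TriSet A γ' ∧ γ'.LeR (G c')

/-- Some execution from an admissible initial store reaches the control point `c` with store `σ`. -/
def Reaches (mach : Machine M Val Op) (P : Program B R Val Op) (Init : Set (Store R M Val))
    (c : B × ℕ) (σ : Store R M Val) : Prop :=
  ∃ σ₀ ∈ Init, ∃ tr, Exec mach P P.start σ₀ tr c σ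

theorem Reaches.step {c c' : B × ℕ} {σ σ' : Store R M Val} {a} (h : Reaches mach P Init c σ)
    (hs : Step mach P c σ a c' σ') : Reaches mach P Init c' σ' :=
  let ⟨σ₀, h₀, _, he⟩ := h; ⟨σ₀, h₀, _, he.snoc hs⟩

theorem Reaches.mem_ptsTo (hpts : PtsToCorrect mach P Init ptsTo) {c : B × ℕ}
    {σ : Store R M Val} (h : Reaches mach P Init c σ) :
    ∀ x m, σ.get x = mach.addr m → m ∈ ptsTo c x :=
  let ⟨σ₀, h₀, _, he⟩ := h; hpts σ₀ h₀ _ _ _ he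

theorem Step.exists_link {c c' : B × ℕ} {σ σ' : Store R M Val} {a}
    (hpts : PtsToCorrect mach P Init ptsTo)
    (hE : ∀ c c', P.Succ c c' → EdgeTyped mach P selfDep ptsTo G c c')
    (hs : Step mach P c σ a c' σ') (hR : Reaches mach P Init c σ) :
    ∃ S K, (G c).Upd S K (G c') ∧ Link P G c σ c' σ' K ∧ ∀ r, P.AssignsAt c r → .inl r ∈ S := by
  obtain ⟨γ, _, A, ht, ⟨l', -, -, rfl⟩, hle⟩ := hE c c' hs.succ
  obtain ⟨S, l, h1, h2, h3, h4, h5⟩ := ht.shape hs (hR.mem_ptsTo hpts)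
  have hU : (G c).Upd S _ (G c') := ⟨l, γ, l', rfl, h1, h2, h3, hle⟩
  exact ⟨S, _, hU, ⟨S, hU, hs.succ, h4, fun r => (h5 r).1⟩, fun r => (h5 r).2⟩

theorem Tracked.exec {c c' j : B × ℕ} {σ σ' σj : Store R M Val} {r L y W tr}
    (hpts : PtsToCorrect mach P Init ptsTo)
    (hE : ∀ c c', P.Succ c c' → EdgeTyped mach P selfDep ptsTo G c c')
    (he : Exec mach P c σ tr c' σ') (hR : Reaches mach P Init c σ)
    (h : Tracked P G r L y j σj c σ (G c) W) :
    ∃ W', Tracked P G r L y j σj c' σ' (G c') W' := by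
  induction he generalizing W with
  | refl => exact ⟨W, h⟩
  | step hs _ ih =>
    obtain ⟨S, K, hU, hl, hS⟩ := hs.exists_link hpts hE hR
    exact ih (hR.step hs) (h.step hl hS hU)

/-- The branch joins the type of `r` to the leakage type, so the chain of `r` becomes one of the
leakage variable: directly if `r ∉ XO`, through the symbol of `r` otherwise. -/
theorem Tracked.of_cond {c c' j : B × ℕ} {σ σ' σj : Store R M Val} {r L y W a b₁ b₂}
    (hE : ∀ c c', P.Succ c c' → EdgeTyped mach P selfDep ptsTo G c c')
    (hc : P.code c = some (.cond r b₁ b₂)) (hs : Step mach P c σ a c' σ')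
    (hR : Run P G (¬ P.AssignsAt · r) j σj W c σ)
    (hL : (G j).Chain (some (.inl r)) L y) :
    ∃ W', Tracked P G r L y j σj c' σ' (G c') W' := by
  obtain ⟨γ, _, A, ht, ⟨l, -, -, rfl⟩, hle⟩ := hE c c' hs.succ
  obtain ⟨b, n⟩ := c
  obtain ⟨rfl, -⟩ := hs.inv_cond hc
  obtain rfl : γ = (G (b, n)).set none (G (b, n) none ⊔ (G (b, n)).sym (.inl r)) := by
    cases ht <;> simp_all
  have hnA : ∀ x, ¬ P.AssignsAt (b, n) x := by simp [Program.AssignsAt, hc, Instr.Assigns]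
  have hC := hR.chain hL
  set Γ := G (b, n)
  set γ := Γ.set none (Γ none ⊔ Γ.sym (.inl r))
  have hγ : ∀ x, γ (some x) = Γ (some x) := fun x => Env.set_of_ne _ _ (by simp)
  have hγn : γ none = Γ none ⊔ Γ.sym (.inl r) := Env.set_self _ _ _
  have hCγ : γ.Chain (some (.inl r)) (Env.drop W L) y :=
    hC.mono (hγ _).ge fun o _ => (hγ o).ge
  have hT : Tracked P G r L y j σj (b, n) σ' γ W := by
    by_cases hr : Sum.inl r ∈ XO
    · refine Or.inr ⟨hr, hR, ?_, hCγ⟩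
      rw [hγn, Env.sym, dif_pos hr]
      exact Or.inr rfl
    · refine Or.inl ⟨hR.mono fun _ _ => trivial, hCγ.of_subset ?_⟩
      rw [hγn, Env.sym, dif_neg hr, hγ]
      exact Set.subset_union_right
  have hn : Γ none ≤ γ none := by
    rw [hγn]
    exact le_sup_left
  -- The edge is used twice: from `Γ` for the run, and from `γ`, where the chain has already entered
  -- the leakage type, for the tracking.
  have hU : Γ.Upd ∅ {o | o ∈ l} (G c') :=
    ⟨[], γ, l, by simp, by simp, fun x _ => hγ x, hn, hle⟩
  have hU' : γ.Upd ∅ {o | o ∈ l} (G c') :=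
    ⟨[], γ, l, by simp, by simp, fun x _ => rfl, le_rfl, hle⟩
  exact ⟨_, hT.step ⟨∅, hU, hs.succ, fun _ _ => rfl, by simp⟩ (fun x hx => (hnA x hx).elim) hU'⟩

/-- The origin of a difference of two stores at a register `r`: at the last assignment to `r` there
was a chain of dependencies of `r` along which the stores differed. -/
def Record (P : Program B R Val Op) (G : B × ℕ → Env XO) (I : Set (R ⊕ M)) (r : R) (c : B × ℕ)
    (σ ρ : Store R M Val) : Prop :=
  ∃ j σj ρj L y W W', y ∈ I ∧ (∀ o ∈ L, σj.get o ≠ ρj.get o) ∧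
    (G j).Chain (some (.inl r)) L y ∧ Run P G (¬ P.AssignsAt · r) j σj W c σ ∧
    Run P G (¬ P.AssignsAt · r) j ρj W' c ρ ∧
    (L = [] ∨ ∀ c₁ c₂, P.AssignsAt c₁ r → P.Succ c₁ c₂ → c₂ = j)

variable {I : Set (R ⊕ M)}

/-- Two executions that diverge at a branching instruction do not end in equivalent stores. -/
theorem Record.false_of_diverge {c c₁ c₂ : B × ℕ} {σ ρ σ₁ ρ₁ σ' ρ' : Store R M Val}
    {r b₁ b₂ a₁ a₂ tr₁ tr₂}
    (hpts : PtsToCorrect mach P Init ptsTo) (hG : ∀ c, (G c).WellFormed)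
    (hE : ∀ c c', P.Succ c c' → EdgeTyped mach P selfDep ptsTo G c c')
    (hI : ∀ y ∈ I, Sum.inl y ∉ G P.final none) (hO : Store.EqOn XO σ' ρ')
    (h : Record P G I r c σ ρ) (hc : P.code c = some (.cond r b₁ b₂)) (hne : σ.reg r ≠ ρ.reg r)
    (hσ : Reaches mach P Init c σ) (hρ : Reaches mach P Init c ρ)
    (hs : Step mach P c σ a₁ c₁ σ₁) (hs' : Step mach P c ρ a₂ c₂ ρ₁)
    (he : Exec mach P c₁ σ₁ tr₁ P.final σ') (he' : Exec mach P c₂ ρ₁ tr₂ P.final ρ') : False := by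
  obtain ⟨j, σj, ρj, L, y, W, W', hy, hd, hL, hR, hR', hj⟩ := h
  obtain ⟨_, hT⟩ := Tracked.of_cond hE hc hs hR hL
  obtain ⟨_, hT'⟩ := Tracked.of_cond hE hc hs' hR' hL
  obtain ⟨_, hT⟩ := hT.exec hpts hE he (hσ.step hs)
  obtain ⟨_, hT'⟩ := hT'.exec hpts hE he' (hρ.step hs')
  obtain ⟨x, hx, hxL, h1, h2⟩ := hT.exists_get_eq hG hL (hI y hy) hj hT'
  have heq := hO x hx
  rw [h1, h2] at heq
  rcases hxL with rfl | ⟨_, hxL⟩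
  · exact hne (hR.reg_eq.trans (heq.trans hR'.reg_eq.symm))
  · exact hd _ hxL heq

/-- An assignment to `r` starts a new record at `c'`, with a chain of bad atoms supplied by `Sound`.
Any other step prolongs the two runs of the old record. -/
theorem Record.step {c c' : B × ℕ} {σ ρ σ' ρ' : Store R M Val} {r : R} {a₁ a₂} {D : Prop}
    (hXO : XO.Finite) (hpts : PtsToCorrect mach P Init ptsTo) (hG : ∀ c, (G c).WellFormed)
    (hE : ∀ c c', P.Succ c c' → EdgeTyped mach P selfDep ptsTo G c c')
    (hr : ∀ c₁ c₂, P.AssignsAt c₁ r → P.AssignsAt c₂ r → c₁ = c₂)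
    (h : σ.reg r ≠ ρ.reg r → Record P G I r c σ ρ)
    (hσ : Reaches mach P Init c σ) (hρ : Reaches mach P Init c ρ)
    (hs : Step mach P c σ a₁ c' σ') (hs' : Step mach P c ρ a₂ c' ρ')
    (hS : Sound I (G c') σ' ρ' D) (hne : σ'.reg r ≠ ρ'.reg r) : Record P G I r c' σ' ρ' := by
  by_cases hA : P.AssignsAt c r
  · obtain ⟨a, ha, hb⟩ := hS.1 (.inl r) hne
    obtain ⟨L, y, hL, hy, hd⟩ :=
      Env.exists_chain hXO (hG c') (p := Bad I σ' ρ') (fun o ho => hS.1 o ho) ha hb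
    refine ⟨c', σ', ρ', L, y, ∅, ∅, hy, hd, hL, .refl, .refl, Or.inr fun c₁ c₂ h₁ h₂ => ?_⟩
    obtain rfl := hr _ _ h₁ hA
    exact h₂.eq_of_assignsAt hA hs.succ
  · obtain ⟨_, K, -, hl, -⟩ := hs.exists_link hpts hE hσ
    obtain ⟨_, K', -, hl', -⟩ := hs'.exists_link hpts hE hρ
    have hQ : ∀ {τ τ' : Store R M Val} {K}, Link P G c τ c' τ' K → τ'.reg r = τ.reg r :=
      fun hl => (Run.refl.step hA hl : Run P G (¬ P.AssignsAt · r) c _ _ c' _).reg_eq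
    rw [hQ hl, hQ hl'] at hne
    obtain ⟨j, σj, ρj, L, y, W, W', hy, hd, hL, hR, hR', hj⟩ := h hne
    exact ⟨j, σj, ρj, L, y, _, _, hy, hd, hL, hR.step hA hl, hR'.step hA hl', hj⟩

/-- `D` says that the traces already differ before `c`; carrying it along lets the final leakage
type decide about all steps at once. -/
theorem trace_eq {c e : B × ℕ} {σ ρ σ' ρ' : Store R M Val} {tr₁ tr₂} {D : Prop}
    (hXO : XO.Finite) (hpts : PtsToCorrect mach P Init ptsTo) (hG : ∀ c, (G c).WellFormed)
    (hE : ∀ c c', P.Succ c c' → EdgeTyped mach P selfDep ptsTo G c c')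
    (hbr : P.BranchRegsAssignedOnce)
    (hI : ∀ y ∈ I, Sum.inl y ∉ G P.final none) (hO : Store.EqOn XO σ' ρ')
    (he : Exec mach P c σ tr₁ e σ') (hef : e = P.final) (he' : Exec mach P c ρ tr₂ P.final ρ')
    (hσ : Reaches mach P Init c σ) (hρ : Reaches mach P Init c ρ)
    (hS : Sound I (G c) σ ρ D)
    (hRec : ∀ c₀ r b₁ b₂, P.code c₀ = some (.cond r b₁ b₂) → σ.reg r ≠ ρ.reg r →
      Record P G I r c σ ρ) :
    ¬ D ∧ tr₁ = tr₂ := by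
  induction he generalizing ρ tr₂ D with
  | refl =>
    subst hef
    cases he' with
    | refl =>
      refine ⟨fun hD => ?_, rfl⟩
      obtain ⟨y | o, ha, hb⟩ := hS.2 hD
      · exact hI y hb ha
      · exact hb (hO o o.2)
    | step hs _ => exact absurd hs not_step_final
  | step hs he ih =>
    subst hef
    cases he' with
    | refl => exact absurd hs not_step_final
    | @step _ _ _ c₂ _ _ _ _ hs' he' =>
      rename_i c σ a c₁ σ₁ tr σ' a' ρ₁ tr'
      by_cases hcc : c₁ = c₂
      · subst hcc
        obtain ⟨γ, _, A, ht, ⟨l, -, -, rfl⟩, hle⟩ := hE c c₁ hs.succ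
        have hS' : Sound I (G c₁) σ₁ ρ₁ (D ∨ a ≠ a') :=
          ((hS.typeStep (hG c) ((hG c₁).noSelf.of_leR hle).of_foldl ht hs hs'
            (hσ.mem_ptsTo hpts) (hρ.mem_ptsTo hpts)).foldl l).mono hle.1
        obtain ⟨h1, rfl⟩ := ih hO rfl he' (hσ.step hs) (hρ.step hs') hS'
          fun c₀ r b₁ b₂ h₀ => Record.step hXO hpts hG hE
            (fun k₁ k₂ ⟨i₁, h₁, h₁'⟩ ⟨i₂, h₂, h₂'⟩ =>
              hbr c₀ r b₁ b₂ h₀ k₁ k₂ i₁ i₂ h₁ h₂ h₁' h₂')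
            (hRec c₀ r b₁ b₂ h₀) hσ hρ hs hs' hS'
        rw [not_or, not_not] at h1
        exact ⟨h1.1, by rw [h1.2]⟩
      · obtain ⟨r, b₁, b₂, hc, hne⟩ := hs.exists_cond_of_ne hs' hcc
        exact ((hRec c r b₁ b₂ hc hne).false_of_diverge hpts hG hE hI hO hc hne hσ hρ hs hs'
          he he').elim

end Main

end OSCT

theorem mainTheorem5 {B R M Val Op : Type*}
    (mach : OSCT.Machine M Val Op) (P : OSCT.Program B R Val Op)
    (hbr : P.BranchRegsAssignedOnce)
    (XI XO : Set (R ⊕ M)) (hXO : XO.Finite)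
    (Init : Set (OSCT.Store R M Val))
    (ptsTo : B × ℕ → R ⊕ M → Set M) (hpts : OSCT.PtsToCorrect mach P Init ptsTo)
    (selfDep : Set B)
    (Γ Γ' : OSCT.Env XO)
    (hΓ : ∀ x : R ⊕ M, Γ (some x) = OSCT.tau x) (hΓl : Γ none = ⊥)
    (hty : OSCT.WellTyped mach P selfDep ptsTo Γ Γ')
    (hleak : Γ' none ≤ (⨆ x ∈ XI, Γ (some x)) ⊔ ⨆ o : XO, OSCT.alpha o) :
    OSCT.ConstantTime mach P Init XI XO := by
  obtain ⟨G, hG, rfl, rfl, hE⟩ := hty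
  intro σ hσ ρ hρ tr₁ tr₂ σ' ρ' he he' hXI hO
  -- `I` consists of the variables with different initial values, and no action has happened yet, so
  -- `D` is `False`.
  refine (OSCT.trace_eq (I := {y | σ.get y ≠ ρ.get y}) (D := False) hXO hpts hG hE hbr ?_ hO he rfl
    he' ⟨σ, hσ, _, .refl⟩ ⟨ρ, hρ, _, .refl⟩ ⟨fun x hx => ?_, False.elim⟩ ?_).2
  · intro y hy h
    rcases hleak h with h | h
    · obtain ⟨x, hx, h⟩ := Set.mem_iUnion₂.1 h
      rw [hΓ] at h
      obtain rfl := Sum.inl_injective h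
      exact hy (hXI _ hx)
    · obtain ⟨o, h⟩ := Set.mem_iUnion.1 h
      cases h
  · exact ⟨Sum.inl x, by rw [hΓ]; rfl, hx⟩
  · intro _ r _ _ _ hne
    -- At the start each register has its own atom as type: the chain is empty and ends in `r`. The
    -- start need not follow an assignment to `r`, hence the alternative `L = []`.
    refine ⟨P.start, σ, ρ, [], .inl r, ∅, ∅, hne, by simp, ?_, .refl, .refl, Or.inl rfl⟩
    change _ ∈ G P.start _
    rw [hΓ]
    rfl
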